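/- Let $n\ge 4$ and let $W$ be the Weyl group of type $D_n$, realized as the even-signed hyperoctahedral group: the group of all permutations $w$ of $\{1,\dots,n,-n,\dots,-1\}$ such that $w(-i)=-w(i)$ for all $i$ and $\#\{i>0\mid w(i)<0\}$ is even. Put $\Phi^+=\{\epsilon_i\pm\epsilon_j\mid 1\le i<j\le n\}$, with simple roots $\alpha_i=\epsilon_i-\epsilon_{i+1}$ for $1\le i\le n-1$ and $\alpha_n=\epsilon_{n-1}+\epsilon_n$; let $s_i$ be the reflection corresponding to $\alpha_i$ (so $s_i=(i,i+1)(-i,-(i+1))$ for $i<n$ and $s_n=(n-1,-n)(-(n-1),n)$), and let $l(w)$ be the length of $w\in W$ with respect to $s_1,\dots,s_n$. The group $W$ acts on the field $\mathbb{C}(\mathfrak h)=\mathbb{C}(\epsilon_1,\dots,\epsilon_n)$ by automorphisms, with $w(\epsilon_i)=\pm\epsilon_j$ if $w(i)=\pm j$. Let $Q_W$ be the ring that is the $\mathbb{C}(\mathfrak h)$-vector space with basis $\{\delta_w\mid w\in W\}$ and multiplication $f\delta_v\cdot g\delta_w=f\,v(g)\,\delta_{vw}$, and put $x_i=\alpha_i^{-1}(\delta_{s_i}-\delta_{\mathrm{id}})$.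 For $w\in W$ with a reduced decomposition $w=s_{i_1}\cdots s_{i_l}$ put $x_w=x_{i_1}\cdots x_{i_l}$ (this does not depend on the choice of the reduced decomposition) and define $c_{w,v}\in\mathbb{C}(\mathfrak h)$ by $x_w=\sum_{v\in W}c_{w,v}\delta_v$. The Kostant–Kumar polynomial of $w$ is $$d_w=(-1)^{l(w)}\,c_{w,\mathrm{id}}\prod_{\alpha\in\Phi^+}\alpha .$$ An element $w\in W$ is called a basic involution if $w^2=\mathrm{id}$ and $w(i)\ne -i$ for all $i\in\{1,\dots,n\}$. **Proposition.** If $\sigma,\tau\in W$ are distinct basic involutions, then $d_\sigma\neq d_\tau$. -/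

import Mathlib

namespace TypeD

/-- The set `{1, …, n, -n, …, -1}`: the pair `(i, 1)` is the letter `i` and `(i, -1)` is the
letter `-i` (with the indices `1, …, n` shifted to `0, …, n - 1`). -/
abbrev Letter (n : ℕ) : Type := Fin n × ℤˣ

/-- The map `k ↦ -k` on letters. -/
def Letter.opp {n : ℕ} (k : Letter n) : Letter n := (k.1, -k.2)

/-- `w(-k) = -w(k)` for all letters `k`. -/
def IsSigned {n : ℕ} (w : Equiv.Perm (Letter n)) : Prop :=
  ∀ k : Letter n, w k.opp = (w k).opp

/-- The number of `i > 0` with `w(i) < 0`. -/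
def negCount {n : ℕ} (w : Equiv.Perm (Letter n)) : ℕ :=
  (Finset.univ.filter fun i : Fin n => (w (i, 1)).2 = -1).card

theorem even_negCount_iff {n : ℕ} (w : Equiv.Perm (Letter n)) :
    Even (negCount w) ↔ ∏ i : Fin n, (w (i, 1)).2 = 1 := by
  have h : ∏ i : Fin n, (w (i, 1)).2 = (-1) ^ negCount w := by
    rw [negCount, Finset.card_eq_sum_ones, Finset.sum_filter, ← Finset.prod_pow_eq_pow_sum]
    refine Finset.prod_congr rfl fun i _ => ?_
    rcases Int.units_eq_one_or (w (i, 1)).2 with h | h <;> simp [h]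
  rw [h]
  rcases Nat.even_or_odd (negCount w) with h | h
  · simp [h]
  · simp [h.neg_one_pow, Nat.not_even_iff_odd.mpr h]

theorem IsSigned.apply {n : ℕ} {w : Equiv.Perm (Letter n)} (hw : IsSigned w) (i : Fin n)
    (e : ℤˣ) : w (i, e) = ((w (i, 1)).1, e * (w (i, 1)).2) := by
  rcases Int.units_eq_one_or e with rfl | rfl
  · simp
  · have := hw (i, 1)
    simpa [Letter.opp] using this

theorem IsSigned.mul {n : ℕ} {w v : Equiv.Perm (Letter n)} (hw : IsSigned w)
    (hv : IsSigned v) : IsSigned (w * v) := fun k => by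
  simp only [Equiv.Perm.mul_apply, hv k, hw (v k)]

theorem IsSigned.inv {n : ℕ} {w : Equiv.Perm (Letter n)} (hw : IsSigned w) :
    IsSigned w⁻¹ := fun k => by
  rw [Equiv.Perm.inv_eq_iff_eq, hw, ← Equiv.Perm.mul_apply, mul_inv_cancel, Equiv.Perm.one_apply]

theorem IsSigned.bijective {n : ℕ} {w : Equiv.Perm (Letter n)} (hw : IsSigned w) :
    Function.Bijective fun i : Fin n => (w (i, 1)).1 := by
  rw [← Finite.injective_iff_bijective]
  intro i j hij
  have key : w (i, (w (i, 1)).2) = w (j, (w (j, 1)).2) := by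
    rw [hw.apply i (w (i, 1)).2, hw.apply j (w (j, 1)).2]
    simp only [Int.units_mul_self]
    exact Prod.ext hij rfl
  exact congrArg Prod.fst (w.injective key)

theorem IsSigned.prod_mul {n : ℕ} {w v : Equiv.Perm (Letter n)} (hw : IsSigned w)
    (hv : IsSigned v) :
    ∏ i : Fin n, ((w * v) (i, 1)).2 =
      (∏ i : Fin n, (v (i, 1)).2) * ∏ i : Fin n, (w (i, 1)).2 := by
  have h1 : ∀ i : Fin n, ((w * v) (i, 1)).2 = (v (i, 1)).2 * (w ((v (i, 1)).1, 1)).2 := by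
    intro i
    rw [Equiv.Perm.mul_apply]
    conv_lhs => rw [← Prod.mk.eta (p := v (i, 1)), hw.apply]
  simp only [h1, Finset.prod_mul_distrib]
  congr 1
  exact hv.bijective.prod_comp fun j => (w (j, 1)).2

/-- The even-signed hyperoctahedral group, the Weyl group `W` of type `D_n`. -/
def weylGroup (n : ℕ) : Subgroup (Equiv.Perm (Letter n)) where
  carrier := {w | IsSigned w ∧ Even (negCount w)}
  mul_mem' := by
    rintro w v ⟨hw, hw'⟩ ⟨hv, hv'⟩
    rw [even_negCount_iff] at hw' hv'
    refine ⟨hw.mul hv, ?_⟩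
    rw [even_negCount_iff, hw.prod_mul hv, hw', hv', one_mul]
  one_mem' := ⟨fun _ => rfl, by simp [even_negCount_iff]⟩
  inv_mem' := by
    rintro w ⟨hw, hw'⟩
    refine ⟨hw.inv, ?_⟩
    rw [even_negCount_iff] at hw' ⊢
    have h := hw.inv.prod_mul hw
    rw [hw', one_mul] at h
    rw [← h]
    simp

/-- The positive roots of `D_n`: the triple `(i, j, 1)` with `i < j` stands for `ε_i - ε_j`, and
`(i, j, -1)` for `ε_i + ε_j`. -/
abbrev PosRoot (n : ℕ) : Type := {p : Fin n × Fin n × ℤˣ // p.1 < p.2.1}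

/-- The simple roots `ε_1 - ε_2, …, ε_{n-1} - ε_n` and `ε_{n-1} + ε_n`. -/
abbrev SimpleRoot (n : ℕ) : Type :=
  {a : PosRoot n // (a.1.1 : ℕ) + 1 = a.1.2.1 ∧ (a.1.2.2 = 1 ∨ (a.1.2.1 : ℕ) + 1 = n)}

/-- The reflection in a positive root, as a permutation of letters:
`(i, j)(-i, -j)` for `ε_i - ε_j` and `(i, -j)(-i, j)` for `ε_i + ε_j`. -/
def reflectionPerm {n : ℕ} (a : PosRoot n) : Equiv.Perm (Letter n) :=
  Equiv.swap (a.1.1, 1) (a.1.2.1, a.1.2.2) * Equiv.swap (a.1.1, -1) (a.1.2.1, -a.1.2.2)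

theorem reflectionPerm_apply {n : ℕ} (a : PosRoot n) (k : Letter n) :
    reflectionPerm a k =
      if k.1 = a.1.1 then (a.1.2.1, k.2 * a.1.2.2)
      else if k.1 = a.1.2.1 then (a.1.1, k.2 * a.1.2.2) else k := by
  obtain ⟨⟨i, j, e⟩, hij⟩ := a
  obtain ⟨k, d⟩ := k
  have hij : i < j := hij
  have hne : i ≠ j := hij.ne
  have hne' : j ≠ i := hij.ne'
  simp only [reflectionPerm, Equiv.Perm.mul_apply, Equiv.swap_apply_def, Prod.mk.injEq]
  by_cases h1 : k = i
  · subst h1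
    rcases Int.units_eq_one_or e with rfl | rfl <;> rcases Int.units_eq_one_or d with rfl | rfl <;>
      simp [hne, hne']
  · by_cases h2 : k = j
    · subst h2
      rcases Int.units_eq_one_or e with rfl | rfl <;>
        rcases Int.units_eq_one_or d with rfl | rfl <;> simp [hne, hne']
    · simp [h1, h2]

theorem reflectionPerm_mem {n : ℕ} (a : PosRoot n) : reflectionPerm a ∈ weylGroup n := by
  refine ⟨fun k => ?_, ?_⟩
  · simp only [reflectionPerm_apply, Letter.opp]
    split_ifs <;> simp
  · rw [even_negCount_iff]
    have hne : a.1.1 ≠ a.1.2.1 := a.2.ne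
    have h : ∀ i : Fin n, (reflectionPerm a (i, 1)).2 =
        (if i = a.1.1 then a.1.2.2 else 1) * (if i = a.1.2.1 then a.1.2.2 else 1) := by
      intro i
      rw [reflectionPerm_apply]
      by_cases h1 : i = a.1.1
      · have : i ≠ a.1.2.1 := h1 ▸ hne
        simp [h1, hne]
      · by_cases h2 : i = a.1.2.1 <;> simp [h1, h2, hne.symm]
    simp only [h, Finset.prod_mul_distrib, Finset.prod_ite_eq', Finset.mem_univ, if_true,
      Int.units_mul_self]

/-- The reflection `s_α` in a positive root `α`, as an element of `W`. -/
def reflection {n : ℕ} (a : PosRoot n) : weylGroup n := ⟨reflectionPerm a, reflectionPerm_mem a⟩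

/-- The product `s_{i_1} ⋯ s_{i_l}` of simple reflections. -/
def wordProd {n : ℕ} (l : List (SimpleRoot n)) : weylGroup n :=
  (l.map fun a => reflection a.1).prod

/-- `s_{i_1} ⋯ s_{i_l}` is a reduced decomposition of `w`: it equals `w`, and no shorter product of
simple reflections does. -/
def IsReducedDecomposition {n : ℕ} (l : List (SimpleRoot n)) (w : weylGroup n) : Prop :=
  wordProd l = w ∧ ∀ l' : List (SimpleRoot n), wordProd l' = w → l.length ≤ l'.length

theorem reflection_mul_self {n : ℕ} (a : PosRoot n) : reflection a * reflection a = 1 := by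
  apply Subtype.ext
  ext1 k
  have hne : a.1.2.1 ≠ a.1.1 := a.2.ne'
  change reflectionPerm a (reflectionPerm a k) = k
  rw [reflectionPerm_apply, reflectionPerm_apply]
  obtain ⟨k, d⟩ := k
  by_cases h1 : k = a.1.1
  · simp [h1, hne, mul_assoc]
  · by_cases h2 : k = a.1.2.1
    · simp [h2, hne, mul_assoc]
    · simp [h1, h2]

/-- The pairing of the weight `±ε_i` with the half-sum of the positive roots. -/
def rhoVal {n : ℕ} (k : Letter n) : ℤ := (k.2 : ℤ) * ((n : ℤ) - 1 - (k.1 : ℕ))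

theorem exists_descent {n : ℕ} (w : weylGroup n) (hw : w ≠ 1) :
    ∃ a : SimpleRoot n, rhoVal (w.1 (a.1.1.1, 1)) <
      (a.1.1.2.2 : ℤ) * rhoVal (w.1 (a.1.1.2.1, 1)) := by
  by_contra! hcon
  apply hw
  obtain ⟨w, hs, he⟩ := w
  rw [even_negCount_iff] at he
  simp only at hcon
  -- The absolute value of `rhoVal` of the image of `i` is `n - 1 - |w(i)|`.
  have habs : ∀ i : Fin n, |rhoVal (w (i, 1))| = (n : ℤ) - 1 - ((w (i, 1)).1 : ℕ) := by
    intro i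
    have h1 := (w (i, 1)).1.2
    rw [rhoVal, abs_mul, abs_of_nonneg (a := (n : ℤ) - 1 - _) (by omega)]
    rcases Int.units_eq_one_or (w (i, 1)).2 with h | h <;> simp [h]
  have step : ∀ i j : Fin n, (i : ℕ) + 1 = j → rhoVal (w (j, 1)) ≤ rhoVal (w (i, 1)) := by
    intro i j hij
    have := hcon ⟨⟨(i, j, 1), show i < j from Fin.lt_def.mpr (by omega)⟩, hij, Or.inl rfl⟩
    simpa using this
  have last : ∀ i j : Fin n, (i : ℕ) + 1 = j → (j : ℕ) + 1 = n →
      -rhoVal (w (j, 1)) ≤ rhoVal (w (i, 1)) := by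
    intro i j hij hj
    have := hcon ⟨⟨(i, j, -1), show i < j from Fin.lt_def.mpr (by omega)⟩, hij, Or.inr hj⟩
    simpa using this
  have anti : ∀ (d : ℕ) (i j : Fin n), (i : ℕ) + d = j →
      rhoVal (w (j, 1)) ≤ rhoVal (w (i, 1)) := by
    intro d
    induction d with
    | zero => intro i j h; obtain rfl : i = j := Fin.ext (by omega); exact le_rfl
    | succ d ih =>
      intro i j h
      have hm : (i : ℕ) + d < n := by omega
      exact (step ⟨i + d, hm⟩ j (by simp only; omega)).trans (ih i ⟨i + d, hm⟩ rfl)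
  have anti' : ∀ i j : Fin n, i < j → |rhoVal (w (j, 1))| ≤ rhoVal (w (i, 1)) := by
    intro i j hij
    have hij' : (i : ℕ) < j := hij
    refine abs_le'.mpr ⟨anti (j - i) i j (by omega), ?_⟩
    have hn := j.2
    let z : Fin n := ⟨n - 1, by omega⟩
    let y : Fin n := ⟨n - 2, by omega⟩
    have h1 := last y z (by simp only [y, z]; omega) (by simp only [z]; omega)
    have h2 := anti (n - 2 - i) i y (by simp only [y]; omega)
    have h3 := anti (n - 1 - j) j z (by simp only [z]; omega)
    linarith
  have hmono : StrictMono fun i : Fin n => (w (i, 1)).1 := by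
    refine Monotone.strictMono_of_injective ?_ hs.bijective.1
    refine monotone_iff_forall_lt.mpr fun i j hij => ?_
    have h1 := (anti' i j hij).trans (le_abs_self _)
    rw [habs, habs] at h1
    exact Fin.le_def.mpr (by omega)
  have hid : ∀ i : Fin n, (w (i, 1)).1 = i := by
    have := (hmono.range_inj (strictMono_id (α := Fin n))).mp
      (by rw [hs.bijective.2.range_eq, Set.range_id])
    exact fun i => congrFun this i
  have hsign : ∀ i j : Fin n, i < j → (w (i, 1)).2 = 1 := by
    intro i j hij
    have hij' : (i : ℕ) < j := hij
    have hj := j.2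
    have h1 := (abs_nonneg _).trans (anti' i j hij)
    rw [rhoVal, hid] at h1
    rcases Int.units_eq_one_or (w (i, 1)).2 with h | h
    · exact h
    · rw [h] at h1
      simp only [Units.val_neg, Units.val_one] at h1
      omega
  have hsign' : ∀ i : Fin n, (w (i, 1)).2 = 1 := by
    intro i
    by_cases h : ∃ j, i < j
    · obtain ⟨j, hj⟩ := h
      exact hsign i j hj
    · push Not at h
      rw [Finset.prod_eq_single i (fun j _ hj => hsign j i (lt_of_le_of_ne (h j) hj))
        (by simp)] at he
      exact he
  apply Subtype.ext
  ext1 k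
  change w k = k
  obtain ⟨i, e⟩ := k
  rw [hs.apply, hid, hsign', mul_one]

theorem exists_wordProd_eq {n : ℕ} (w : weylGroup n) : ∃ l : List (SimpleRoot n),
    wordProd l = w := by
  let H : weylGroup n → ℤ := fun w => ∑ i : Fin n, rhoVal (i, 1) * rhoVal (w.1 (i, 1))
  by_contra hbad
  obtain ⟨w, hw, hmax⟩ := Set.exists_max_image
    {w : weylGroup n | ¬ ∃ l : List (SimpleRoot n), wordProd l = w} H (Set.toFinite _) ⟨w, hbad⟩
  have hw1 : w ≠ 1 := by
    rintro rfl
    exact hw ⟨[], rfl⟩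
  obtain ⟨a, ha⟩ := exists_descent w hw1
  have hnot : H w < H (w * reflection a.1) → False := by
    intro hlt
    have : ∃ l : List (SimpleRoot n), wordProd l = w * reflection a.1 := by
      by_contra h
      exact absurd (hmax _ h) (not_le.mpr hlt)
    obtain ⟨l, hl⟩ := this
    refine hw ⟨l ++ [a], ?_⟩
    rw [wordProd, List.map_append, List.prod_append]
    change wordProd l * _ = w
    rw [hl, List.map_singleton, List.prod_singleton, mul_assoc, reflection_mul_self, mul_one]
  apply hnot
  obtain ⟨⟨⟨i, j, e⟩, hij⟩, hij', he⟩ := a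
  simp only at ha hij hij' he
  have hne : i ≠ j := hij.ne
  have hval : ∀ (k : Fin n) (d : ℤˣ), rhoVal (w.1 (k, d)) = d * rhoVal (w.1 (k, 1)) := by
    intro k d
    rw [w.2.1.apply k d, rhoVal, rhoVal, Units.val_mul, mul_assoc]
  rw [← sub_pos]
  simp only [H, ← Finset.sum_sub_distrib]
  rw [Finset.sum_eq_add_of_mem i j (Finset.mem_univ _) (Finset.mem_univ _) hne]
  · change 0 < _ * rhoVal (w.1 (reflectionPerm _ _)) - _ +
      (_ * rhoVal (w.1 (reflectionPerm _ _)) - _)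
    simp only [reflectionPerm_apply, hne.symm, if_true, if_false, one_mul, hval _ e]
    have hi : rhoVal (i, 1) = rhoVal (j, 1) + 1 := by
      simp only [rhoVal, Units.val_one, one_mul, ← hij']
      push_cast
      ring
    rw [hi]
    rcases Int.units_eq_one_or e with rfl | rfl
    · simp only [Units.val_one, one_mul] at ha ⊢
      linarith
    · have h0 : rhoVal (j, 1) = 0 := by
        have : (j : ℕ) + 1 = n := he.resolve_left (by decide)
        simp only [rhoVal, Units.val_one, one_mul]
        omega
      rw [h0]
      simp only [Units.val_neg, Units.val_one] at ha ⊢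
      linarith
  · rintro k - ⟨hki, hkj⟩
    change _ * rhoVal (w.1 (reflectionPerm _ _)) - _ = 0
    simp only [reflectionPerm_apply, hki, hkj, if_false, sub_self]

theorem exists_isReducedDecomposition {n : ℕ} (w : weylGroup n) :
    ∃ l : List (SimpleRoot n), IsReducedDecomposition l w := by
  classical
  have h : ∃ m : ℕ, ∃ l : List (SimpleRoot n), wordProd l = w ∧ l.length = m :=
    let ⟨l, hl⟩ := exists_wordProd_eq w
    ⟨l.length, l, hl, rfl⟩
  obtain ⟨l, hl, hlen⟩ := Nat.find_spec h
  exact ⟨l, hl, fun l' hl' => hlen ▸ Nat.find_min' h ⟨l', hl', rfl⟩⟩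

/-- `ℂ[𝔥]`, where the variable `X i` is the linear function `ε_{i+1}` on `𝔥`. -/
abbrev Poly (n : ℕ) : Type := MvPolynomial (Fin n) ℂ

/-- The field `ℂ(𝔥)` of rational functions on `𝔥`. -/
abbrev RatFun (n : ℕ) : Type := FractionRing (Poly n)

/-- The linear function `±ε_i` attached to a letter `±i`. -/
noncomputable def weight {n : ℕ} (k : Letter n) : Poly n := k.2 • MvPolynomial.X k.1

/-- A positive root, as a linear function on `𝔥`. -/
noncomputable def rootPoly {n : ℕ} (a : PosRoot n) : Poly n :=
  weight (a.1.1, 1) - weight (a.1.2.1, a.1.2.2)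

theorem aeval_weight {n : ℕ} (w : weylGroup n) (k : Letter n) :
    MvPolynomial.aeval (fun i : Fin n => weight (w.1 (i, 1))) (weight k) =
      weight (w.1 k) := by
  obtain ⟨i, e⟩ := k
  rw [w.2.1.apply i e]
  rcases Int.units_eq_one_or e with rfl | rfl <;> simp [weight, Units.smul_def]

/-- The action of `W` on `ℂ[𝔥]` by algebra automorphisms, with `w(ε_i) = ±ε_j` if `w(i) = ±j`. -/
noncomputable instance polyAction (n : ℕ) : MulSemiringAction (weylGroup n) (Poly n) where
  smul w f := MvPolynomial.aeval (fun i : Fin n => weight (w.1 (i, 1))) f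
  one_smul f := by
    change MvPolynomial.aeval (fun i : Fin n => weight (i, 1)) f = f
    simp [weight]
  mul_smul w v f := by
    change MvPolynomial.aeval _ f = MvPolynomial.aeval _ (MvPolynomial.aeval _ f)
    rw [← AlgHom.comp_apply, MvPolynomial.comp_aeval]
    simp only [aeval_weight]
    rfl
  smul_zero w := map_zero (MvPolynomial.aeval _)
  smul_add w := map_add (MvPolynomial.aeval _)
  smul_one w := map_one (MvPolynomial.aeval _)
  smul_mul w := map_mul (MvPolynomial.aeval _)

theorem smul_weight {n : ℕ} (w : weylGroup n) (k : Letter n) :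
    w • weight k = weight (w.1 k) := aeval_weight w k

/-- The induced action of `W` on `ℂ(𝔥)` by field automorphisms. -/
noncomputable instance ratFunAction (n : ℕ) : MulSemiringAction (weylGroup n) (RatFun n) :=
  IsFractionRing.mulSemiringAction (weylGroup n) (Poly n) (RatFun n)

theorem smul_algebraMap {n : ℕ} (w : weylGroup n) (f : Poly n) :
    w • algebraMap (Poly n) (RatFun n) f = algebraMap (Poly n) (RatFun n) (w • f) :=
  IsFractionRing.ringEquivOfRingEquiv_algebraMap _ f

/-- The nil-Hecke ring `Q_W`: the `ℂ(𝔥)`-vector space with basis `δ_w` (`w ∈ W`) and the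
multiplication `f δ_v * g δ_w = f v(g) δ_{vw}`; the element `f δ_w` is
`SkewMonoidAlgebra.single w f`. -/
abbrev NilHecke (n : ℕ) : Type := SkewMonoidAlgebra (RatFun n) (weylGroup n)

theorem single_mul_single {n : ℕ} (v w : weylGroup n) (f g : RatFun n) :
    (SkewMonoidAlgebra.single v f * SkewMonoidAlgebra.single w g : NilHecke n) =
      SkewMonoidAlgebra.single (v * w) (f * v • g) :=
  SkewMonoidAlgebra.single_mul_single

/-- The element `x_i = α_i⁻¹ (δ_{s_i} - δ_id)` attached to a simple root `α_i`. -/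
noncomputable def nilHeckeGen {n : ℕ} (a : SimpleRoot n) : NilHecke n :=
  (algebraMap (Poly n) (RatFun n) (rootPoly a.1))⁻¹ •
    (SkewMonoidAlgebra.single (reflection a.1) 1 - SkewMonoidAlgebra.single 1 1)

/-- A reduced decomposition of `w`, fixed once and for all. -/
noncomputable def reducedDecomposition {n : ℕ} (w : weylGroup n) : List (SimpleRoot n) :=
  (exists_isReducedDecomposition w).choose

/-- The length `l(w)` with respect to the simple roots. -/
noncomputable def length {n : ℕ} (w : weylGroup n) : ℕ := (reducedDecomposition w).length

/-- The element `x_w = x_{i_1} ⋯ x_{i_l}`, where `s_{i_1} ⋯ s_{i_l}` is a reduced decomposition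
of `w`. -/
noncomputable def nilHeckeBasis {n : ℕ} (w : weylGroup n) : NilHecke n :=
  ((reducedDecomposition w).map nilHeckeGen).prod

/-- The coefficients `c_{w,v}` in `x_w = ∑ v, c_{w,v} δ_v`. -/
noncomputable def nilHeckeCoeff {n : ℕ} (w v : weylGroup n) : RatFun n :=
  (nilHeckeBasis w).coeff v

/-- The Kostant–Kumar polynomial `d_w = (-1)^{l(w)} c_{w,id} ∏_{α > 0} α`, as an element
of `ℂ(𝔥)`. -/
noncomputable def kostantKumar {n : ℕ} (w : weylGroup n) : RatFun n :=
  (-1) ^ length w * nilHeckeCoeff w 1 *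
    ∏ a : PosRoot n, algebraMap (Poly n) (RatFun n) (rootPoly a)

/-- A basic involution: `w² = id`, and `w(i) ≠ -i` for all `i`. -/
def IsBasicInvolution {n : ℕ} (w : weylGroup n) : Prop :=
  w ^ 2 = 1 ∧ ∀ i : Fin n, w.1 (i, 1) ≠ (i, -1)

end TypeD

namespace TypeD

/-! The product of the positive roots is a common nonzero factor, so it suffices to recover a basic
involution `w` from `signedCoeff w`, that is, from its partial fraction decompositions.

Suppose `w` fixes all letters of index below `k`. If it also fixes `k`, its coefficient does not
involve `ε_k` (`shift_signedCoeff`). Otherwise `w(k) = j` with index of `j` above `k`, since `w(k) =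
-k` is excluded. Choose a simple root `a₀ = ε_k - ε_q` and a shortest path `A` of simple reflections
from `q` to `j` that do not touch `k`. Conjugating `w` back along `A` shortens it by two at each
step and ends in `b s_{a₀}`, where `b` is a basic involution fixing the indices up to `k + 1`
(`IsPath.exists_factorization`). Hence, for a reduced word `B` of `b`, the word `A, B, a₀,
A.reverse` is a reduced word of `w`, and `ε_k` enters its product through the single letter `a₀`.

Expanding at this letter gives a sum of simple fractions `H m / (ε_k - ε_m)` with `H m` free of
`ε_k` (`nilCoeff_eq_sum_polePart`). The letters `m` that occur are images of `q` under subwords of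
`A`. A simple reflection lowers the height `rhoVal` by at most one, so only the full word `A` gets
as low as `j`. Therefore `j` is the lowest pole, and its numerator is `signedCoeff b` up to nonzero
factors and a field automorphism that depend on `A` only (`IsPath.polePart_eq`).

By uniqueness of partial fractions (`partialFraction_unique`), the coefficient determines whether
`w` fixes `k`, then `j`, then `signedCoeff b`. Induction on the number of letters not yet known to
be fixed recovers `b`, and with it `w`; the same induction shows that the lowest numerator never
vanishes. -/

variable {n : ℕ}

/-! ### Letters, simple reflections and heights -/

/-- The letter `p` of a simple root `ε_p - ε_q`. -/
def upper (a : SimpleRoot n) : Letter n := (a.1.1.1, 1)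

/-- The letter `q` of a simple root `ε_p - ε_q`. -/
def lower (a : SimpleRoot n) : Letter n := (a.1.1.2.1, a.1.1.2.2)

/-- The simple reflection attached to a simple root. -/
def refl (a : SimpleRoot n) : weylGroup n := reflection a.1

theorem opp_opp (p : Letter n) : p.opp.opp = p := by simp [Letter.opp]

theorem opp_fst (p : Letter n) : p.opp.1 = p.1 := rfl

theorem apply_opp (w : weylGroup n) (p : Letter n) : w.1 p.opp = (w.1 p).opp := w.2.1 p

theorem rhoVal_opp (p : Letter n) : rhoVal p.opp = -rhoVal p := by
  simp [rhoVal, Letter.opp]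

theorem eq_or_eq_opp {p q : Letter n} (h : p.1 = q.1) : p = q ∨ p = q.opp := by
  obtain ⟨i, e⟩ := p
  obtain ⟨j, d⟩ := q
  obtain rfl : i = j := h
  rcases Int.units_eq_one_or e with rfl | rfl <;> rcases Int.units_eq_one_or d with rfl | rfl <;>
    simp [Letter.opp]

theorem inv_apply_apply (w : weylGroup n) (p : Letter n) : w⁻¹.1 (w.1 p) = p :=
  w.1.symm_apply_apply p

theorem apply_inv_apply (w : weylGroup n) (p : Letter n) : w.1 (w⁻¹.1 p) = p :=
  w.1.apply_symm_apply p

theorem mul_apply (v w : weylGroup n) (p : Letter n) : (v * w).1 p = v.1 (w.1 p) := rfl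

theorem one_apply (p : Letter n) : (1 : weylGroup n).1 p = p := rfl

theorem ext_apply {v w : weylGroup n} (h : ∀ p, v.1 p = w.1 p) : v = w :=
  Subtype.ext (Equiv.ext h)

theorem apply_fst_ne (w : weylGroup n) {p q : Letter n} (h : p.1 ≠ q.1) :
    (w.1 p).1 ≠ (w.1 q).1 := by
  intro he
  rcases eq_or_eq_opp he with h1 | h1
  · exact h (congrArg Prod.fst (w.1.injective h1))
  · rw [← apply_opp] at h1
    have h2 : p = q.opp := w.1.injective h1
    exact h (by rw [h2, opp_fst])

/-- Heights separate letters of different index, so every root `ε_p - ε_q` is either positive or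
negative. The index condition matters: the last letter and its opposite both have height `0`. -/
theorem rhoVal_ne {p q : Letter n} (h : p.1 ≠ q.1) : rhoVal p ≠ rhoVal q := by
  obtain ⟨i, e⟩ := p
  obtain ⟨j, d⟩ := q
  have h' : (i : ℕ) ≠ j := fun hc => h (Fin.ext hc)
  have := i.2
  have := j.2
  rcases Int.units_eq_one_or e with rfl | rfl <;> rcases Int.units_eq_one_or d with rfl | rfl <;>
    simp [rhoVal] <;> omega

theorem refl_mul_self (a : SimpleRoot n) : refl a * refl a = 1 := reflection_mul_self _

theorem refl_inv (a : SimpleRoot n) : (refl a)⁻¹ = refl a :=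
  inv_eq_of_mul_eq_one_left (refl_mul_self a)

theorem refl_mul_refl_mul (a : SimpleRoot n) (w : weylGroup n) : refl a * (refl a * w) = w := by
  rw [← mul_assoc, refl_mul_self, one_mul]

theorem upper_fst_ne_lower_fst (a : SimpleRoot n) : (upper a).1 ≠ (lower a).1 := a.1.2.ne

theorem refl_apply (a : SimpleRoot n) (k : Letter n) : (refl a).1 k =
    if k.1 = a.1.1.1 then (a.1.1.2.1, k.2 * a.1.1.2.2)
      else if k.1 = a.1.1.2.1 then (a.1.1.1, k.2 * a.1.1.2.2) else k :=
  reflectionPerm_apply a.1 k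

theorem refl_upper (a : SimpleRoot n) : (refl a).1 (upper a) = lower a := by
  simp [refl_apply, upper, lower]

theorem refl_lower (a : SimpleRoot n) : (refl a).1 (lower a) = upper a := by
  rw [← refl_upper, ← mul_apply, refl_mul_self, one_apply]

theorem refl_of_ne (a : SimpleRoot n) {p : Letter n} (h : p.1 ≠ (upper a).1)
    (h' : p.1 ≠ (lower a).1) : (refl a).1 p = p := by
  rw [refl_apply]
  exact (if_neg h).trans (if_neg h')

theorem lower_fst_val (a : SimpleRoot n) : ((lower a).1 : ℕ) = (upper a).1 + 1 := a.2.1.symm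

theorem rhoVal_lower_lt_upper (a : SimpleRoot n) : rhoVal (lower a) < rhoVal (upper a) := by
  obtain ⟨⟨⟨i, j, e⟩, hij⟩, h, -⟩ := a
  have := j.2
  rcases Int.units_eq_one_or e with rfl | rfl <;> simp [rhoVal, upper, lower] at h ⊢ <;> omega

/-- This bound makes shortest paths rigid: a word of `m` simple reflections lowers the height by at
most `m`, so a path that loses one unit per letter has no letter to spare. -/
theorem rhoVal_le_refl (a : SimpleRoot n) (p : Letter n) :
    rhoVal p ≤ rhoVal ((refl a).1 p) + 1 := by
  obtain ⟨⟨⟨i, j, e⟩, hij⟩, h, h'⟩ := a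
  obtain ⟨k, d⟩ := p
  have := j.2
  simp only [refl_apply] at h h' ⊢
  rcases Int.units_eq_one_or e with rfl | rfl <;> rcases Int.units_eq_one_or d with rfl | rfl <;>
    split_ifs with h1 h2 <;> simp [rhoVal, h1] at h h' ⊢ <;> (try subst h2) <;> omega

/-- A simple reflection permutes the positive roots other than its own. -/
theorem rhoVal_refl_lt (a : SimpleRoot n) {p q : Letter n} (hpq : p.1 ≠ q.1)
    (h : rhoVal q < rhoVal p) (h1 : (p, q) ≠ (upper a, lower a))
    (h2 : (p, q) ≠ ((lower a).opp, (upper a).opp)) :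
    rhoVal ((refl a).1 q) < rhoVal ((refl a).1 p) := by
  obtain ⟨⟨⟨i, j, e⟩, hij⟩, ha, ha'⟩ := a
  obtain ⟨k, d⟩ := p
  obtain ⟨m, c⟩ := q
  have hj := j.2
  have hk := k.2
  have hm := m.2
  have hkm : (k : ℕ) ≠ m := fun hc => hpq (Fin.ext hc)
  simp only [refl_apply, upper, lower, Letter.opp, ne_eq, Prod.mk.injEq, Fin.ext_iff]
    at ha ha' h1 h2 ⊢
  rcases Int.units_eq_one_or e with rfl | rfl <;> rcases Int.units_eq_one_or d with rfl | rfl <;>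
    rcases Int.units_eq_one_or c with rfl | rfl <;>
    split_ifs <;> simp [rhoVal] at ha ha' h h1 h2 ⊢ <;> omega

/-! ### Inversions and length -/

/-- The ordered pairs of letters `(p, q)`, `p ≠ ±q`, for which the root `ε_p - ε_q` is positive and
`w⁻¹ (ε_p - ε_q)` is negative. -/
def invSet (w : weylGroup n) : Finset (Letter n × Letter n) :=
  Finset.univ.filter fun x => x.1.1 ≠ x.2.1 ∧ rhoVal x.2 < rhoVal x.1 ∧
    rhoVal (w⁻¹.1 x.1) < rhoVal (w⁻¹.1 x.2)

/-- Twice the number of positive roots made negative by `w⁻¹`: each of these roots is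
represented by two pairs of letters. -/
def invCount (w : weylGroup n) : ℕ := (invSet w).card

theorem mem_invSet {w : weylGroup n} {x : Letter n × Letter n} : x ∈ invSet w ↔
    x.1.1 ≠ x.2.1 ∧ rhoVal x.2 < rhoVal x.1 ∧ rhoVal (w⁻¹.1 x.1) < rhoVal (w⁻¹.1 x.2) := by
  simp [invSet]

theorem invCount_one : invCount (1 : weylGroup n) = 0 := by
  rw [invCount, Finset.card_eq_zero, Finset.eq_empty_iff_forall_notMem]
  intro x hx
  rw [mem_invSet, inv_one] at hx
  exact lt_asymm hx.2.1 hx.2.2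

theorem invCount_inv_le (w : weylGroup n) : invCount w⁻¹ ≤ invCount w := by
  refine Finset.card_le_card_of_injOn (fun x => (w.1 x.2, w.1 x.1)) ?_ ?_
  · intro x hx
    obtain ⟨h1, h2, h3⟩ := mem_invSet.mp hx
    rw [inv_inv] at h3
    refine mem_invSet.mpr ⟨apply_fst_ne w h1.symm, h3, ?_⟩
    simpa only [inv_apply_apply] using h2
  · intro x _ y _ hxy
    simp only [Prod.mk.injEq, EmbeddingLike.apply_eq_iff_eq] at hxy
    exact Prod.ext hxy.2 hxy.1

theorem invCount_inv (w : weylGroup n) : invCount w⁻¹ = invCount w :=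
  le_antisymm (invCount_inv_le w) (by simpa using invCount_inv_le w⁻¹)

/-- `a` is a left descent of `w`: the root `w⁻¹ α` is negative. -/
def IsDescent (w : weylGroup n) (a : SimpleRoot n) : Prop :=
  rhoVal (w⁻¹.1 (upper a)) < rhoVal (w⁻¹.1 (lower a))

theorem isDescent_refl_mul (w : weylGroup n) (a : SimpleRoot n) :
    IsDescent (refl a * w) a ↔ ¬ IsDescent w a := by
  have h := rhoVal_ne (apply_fst_ne w⁻¹ (upper_fst_ne_lower_fst a))
  rw [IsDescent, IsDescent, mul_inv_rev, refl_inv, mul_apply, mul_apply, refl_upper, refl_lower,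
    not_lt]
  exact ⟨le_of_lt, fun h' => lt_of_le_of_ne h' h.symm⟩

/-- The reflection permutes the positive roots other than its own, so the only new inversion is the
root of `a`, represented by the pairs `x₁` and `x₂`. -/
theorem invCount_refl_mul {w : weylGroup n} {a : SimpleRoot n} (h : ¬ IsDescent w a) :
    invCount (refl a * w) = invCount w + 2 := by
  have hne := upper_fst_ne_lower_fst a
  have hd := (isDescent_refl_mul w a).mpr h
  let x₁ : Letter n × Letter n := (upper a, lower a)
  let x₂ : Letter n × Letter n := ((lower a).opp, (upper a).opp)
  have h12 : x₁ ≠ x₂ := fun hc => hne (congrArg (fun x => x.1.1) hc)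
  have hinv : ∀ p, (refl a * w)⁻¹.1 p = w⁻¹.1 ((refl a).1 p) := by
    intro p
    rw [mul_inv_rev, refl_inv, mul_apply]
  have hs : ∀ p, (refl a).1 ((refl a).1 p) = p := fun p => by
    rw [← mul_apply, refl_mul_self, one_apply]
  have hx₁ : x₁ ∈ invSet (refl a * w) := mem_invSet.mpr ⟨hne, rhoVal_lower_lt_upper a, hd⟩
  have hx₂ : x₂ ∈ invSet (refl a * w) := by
    refine mem_invSet.mpr ⟨hne.symm, ?_, ?_⟩
    · simpa only [x₂, rhoVal_opp, neg_lt_neg_iff] using rhoVal_lower_lt_upper a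
    · simpa only [x₂, apply_opp, rhoVal_opp, neg_lt_neg_iff, IsDescent] using hd
  have hx₁' : x₁ ∉ invSet w := fun hc => h (mem_invSet.mp hc).2.2
  have hx₂' : x₂ ∉ invSet w := fun hc => h <| by
    simpa only [x₂, apply_opp, rhoVal_opp, neg_lt_neg_iff, IsDescent] using (mem_invSet.mp hc).2.2
  -- Away from the two pairs of the root `a`, the reflection carries the inversions of `w`
  -- bijectively to those of `refl a * w`.
  have key : ((invSet (refl a * w)).erase x₁).erase x₂ =
      (invSet w).map (Equiv.prodCongr (refl a).1 (refl a).1).toEmbedding := by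
    ext x
    rw [Finset.mem_map_equiv, Finset.mem_erase, Finset.mem_erase, mem_invSet, mem_invSet]
    have hsymm : (Equiv.prodCongr (refl a).1 (refl a).1).symm x =
        ((refl a).1 x.1, (refl a).1 x.2) := by
      rw [Equiv.symm_apply_eq]
      exact Prod.ext (hs _).symm (hs _).symm
    rw [hsymm, hinv, hinv]
    constructor
    · rintro ⟨h2, h1, h3, h4, h5⟩
      exact ⟨apply_fst_ne _ h3, rhoVal_refl_lt a h3 h4 h1 h2, h5⟩
    · rintro ⟨h3, h4, h5⟩
      have h1 : ((refl a).1 x.1, (refl a).1 x.2) ≠ x₁ := by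
        intro hc
        rw [Prod.ext_iff] at hc
        rw [hc.1, hc.2] at h5
        exact h h5
      have h2 : ((refl a).1 x.1, (refl a).1 x.2) ≠ x₂ := by
        intro hc
        rw [Prod.ext_iff] at hc
        rw [hc.1, hc.2] at h5
        simp only [x₂, apply_opp, rhoVal_opp, neg_lt_neg_iff] at h5
        exact h h5
      have h6 := rhoVal_refl_lt a h3 h4 h1 h2
      have h7 := apply_fst_ne (refl a) h3
      rw [hs, hs] at h6 h7
      refine ⟨?_, ?_, h7, h6, h5⟩
      · rintro rfl
        simp only [x₂, apply_opp, refl_upper, refl_lower, rhoVal_opp] at h4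
        have := rhoVal_lower_lt_upper a
        omega
      · rintro rfl
        simp only [x₁, refl_upper, refl_lower] at h4
        have := rhoVal_lower_lt_upper a
        omega
  have hcard := congrArg Finset.card key
  rw [Finset.card_map, Finset.card_erase_of_mem (Finset.mem_erase.mpr ⟨h12.symm, hx₂⟩),
    Finset.card_erase_of_mem hx₁] at hcard
  have h2 : 2 ≤ (invSet (refl a * w)).card := by
    rw [← Finset.card_pair h12]
    exact Finset.card_le_card (by
      intro x hx
      rcases Finset.mem_insert.mp hx with rfl | hx
      · exact hx₁
      · exact Finset.mem_singleton.mp hx ▸ hx₂)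
  rw [invCount, invCount]
  omega

theorem IsDescent.invCount_refl_mul {w : weylGroup n} {a : SimpleRoot n} (h : IsDescent w a) :
    invCount (refl a * w) + 2 = invCount w := by
  have h' : ¬ IsDescent (refl a * w) a := by rwa [isDescent_refl_mul, not_not]
  rw [← TypeD.invCount_refl_mul h', refl_mul_refl_mul]

theorem exists_isDescent {w : weylGroup n} (hw : w ≠ 1) : ∃ a, IsDescent w a := by
  obtain ⟨a, ha⟩ := exists_descent w⁻¹ (inv_ne_one.mpr hw)
  refine ⟨a, ?_⟩
  have h := w⁻¹.2.1.apply a.1.1.2.1 a.1.1.2.2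
  refine lt_of_lt_of_eq ha ?_
  rw [lower, h, rhoVal, rhoVal, Units.val_mul, mul_assoc]

theorem wordProd_nil : wordProd ([] : List (SimpleRoot n)) = 1 := rfl

theorem wordProd_cons (a : SimpleRoot n) (l : List (SimpleRoot n)) :
    wordProd (a :: l) = refl a * wordProd l := List.prod_cons

theorem wordProd_append (l l' : List (SimpleRoot n)) :
    wordProd (l ++ l') = wordProd l * wordProd l' := by
  simp [wordProd]

theorem wordProd_singleton (a : SimpleRoot n) : wordProd [a] = refl a := by
  rw [wordProd_cons, wordProd_nil, mul_one]

theorem wordProd_reverse (l : List (SimpleRoot n)) : wordProd l.reverse = (wordProd l)⁻¹ := by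
  induction l with
  | nil => simp [wordProd_nil]
  | cons a l ih =>
    rw [List.reverse_cons, wordProd_append, ih, wordProd_singleton, wordProd_cons, mul_inv_rev,
      refl_inv]

theorem invCount_wordProd_le (l : List (SimpleRoot n)) :
    invCount (wordProd l) ≤ 2 * l.length := by
  induction l with
  | nil => rw [wordProd_nil, invCount_one]; exact Nat.zero_le _
  | cons a l ih =>
    rw [wordProd_cons, List.length_cons]
    by_cases h : IsDescent (wordProd l) a
    · have := h.invCount_refl_mul
      omega
    · have := invCount_refl_mul h
      omega

/-- Strip left descents one at a time: each removes exactly two pairs from the inversion set. -/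
theorem exists_wordProd_eq_two_mul_length (w : weylGroup n) :
    ∃ l, wordProd l = w ∧ 2 * l.length = invCount w := by
  induction hm : invCount w using Nat.strong_induction_on generalizing w with
  | _ m ih =>
    subst hm
    by_cases hw : w = 1
    · exact ⟨[], by rw [hw, wordProd_nil], by rw [hw, invCount_one]; rfl⟩
    · obtain ⟨a, ha⟩ := exists_isDescent hw
      have := ha.invCount_refl_mul
      obtain ⟨l, hl, hlen⟩ := ih _ (by omega) (refl a * w) rfl
      refine ⟨a :: l, by rw [wordProd_cons, hl, refl_mul_refl_mul], ?_⟩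
      rw [List.length_cons]
      omega

/-- Minimality among all words becomes a numerical condition on a single word, which is how the
explicit words below are shown to be reduced. -/
theorem isReducedDecomposition_iff {l : List (SimpleRoot n)} {w : weylGroup n} :
    IsReducedDecomposition l w ↔ wordProd l = w ∧ 2 * l.length = invCount w := by
  constructor
  · rintro ⟨rfl, h⟩
    obtain ⟨l', hl', hlen⟩ := exists_wordProd_eq_two_mul_length (wordProd l)
    have h1 := h l' hl'
    have h2 := invCount_wordProd_le l
    exact ⟨rfl, by omega⟩
  · rintro ⟨rfl, h⟩
    refine ⟨rfl, fun l' hl' => ?_⟩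
    have h2 := invCount_wordProd_le l'
    rw [hl'] at h2
    omega

/-- `l` is a reduced word. -/
def IsReduced (l : List (SimpleRoot n)) : Prop := 2 * l.length = invCount (wordProd l)

theorem IsReduced.of_cons {a : SimpleRoot n} {l : List (SimpleRoot n)} (h : IsReduced (a :: l)) :
    IsReduced l ∧ IsDescent (wordProd (a :: l)) a := by
  rw [IsReduced, wordProd_cons, List.length_cons] at h
  have h1 := invCount_wordProd_le l
  by_cases hd : IsDescent (wordProd l) a
  · have := hd.invCount_refl_mul
    omega
  · have := invCount_refl_mul hd
    exact ⟨by rw [IsReduced]; omega, by rwa [wordProd_cons, isDescent_refl_mul]⟩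

theorem isReduced_reducedDecomposition (w : weylGroup n) :
    wordProd (reducedDecomposition w) = w ∧ IsReduced (reducedDecomposition w) := by
  obtain ⟨h1, h2⟩ := isReducedDecomposition_iff.mp (exists_isReducedDecomposition w).choose_spec
  refine ⟨h1, ?_⟩
  rw [IsReduced]
  refine h2.trans (congrArg _ h1.symm)

theorem two_mul_length (w : weylGroup n) : 2 * length w = invCount w := by
  have := (isReduced_reducedDecomposition w).2
  rwa [IsReduced, (isReduced_reducedDecomposition w).1] at this

/-! ### Coefficients of words in the nil-Hecke ring -/

/-- The linear function `±ε_i`, as an element of `ℂ(𝔥)`. -/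
noncomputable def wt (k : Letter n) : RatFun n := algebraMap (Poly n) (RatFun n) (weight k)

theorem smul_wt (w : weylGroup n) (k : Letter n) : w • wt k = wt (w.1 k) := by
  rw [wt, smul_algebraMap, smul_weight, wt]

theorem wt_opp (k : Letter n) : wt k.opp = -wt k := by
  simp [wt, weight, Letter.opp, Units.smul_def]

theorem weight_injective : Function.Injective (weight : Letter n → Poly n) := by
  rintro ⟨i, e⟩ ⟨j, d⟩ h
  simp only [weight] at h
  have h' := congrArg (MvPolynomial.coeff (Finsupp.single i 1)) h
  rcases Int.units_eq_one_or e with rfl | rfl <;> rcases Int.units_eq_one_or d with rfl | rfl <;>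
    simp [MvPolynomial.coeff_X, Units.smul_def, Finsupp.single_left_inj] at h'
  · rw [h']
  · split_ifs at h' <;> norm_num at h'
  · split_ifs at h' <;> norm_num at h'
  · rw [h']

theorem wt_injective : Function.Injective (wt : Letter n → RatFun n) :=
  (IsFractionRing.injective (Poly n) (RatFun n)).comp weight_injective

theorem wt_sub_ne_zero {p q : Letter n} (h : p ≠ q) : wt p - wt q ≠ 0 :=
  sub_ne_zero.mpr fun hc => h (wt_injective hc)

/-- A simple root, as an element of `ℂ(𝔥)`. -/
noncomputable def rt (a : SimpleRoot n) : RatFun n := wt (upper a) - wt (lower a)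

theorem algebraMap_rootPoly (a : SimpleRoot n) :
    algebraMap (Poly n) (RatFun n) (rootPoly a.1) = rt a := by
  rw [rootPoly, map_sub]
  rfl

theorem upper_ne_lower (a : SimpleRoot n) : upper a ≠ lower a :=
  fun h => upper_fst_ne_lower_fst a (congrArg Prod.fst h)

theorem rt_ne_zero (a : SimpleRoot n) : rt a ≠ 0 := wt_sub_ne_zero (upper_ne_lower a)

theorem smul_rt (w : weylGroup n) (a : SimpleRoot n) :
    w • rt a = wt (w.1 (upper a)) - wt (w.1 (lower a)) := by
  rw [rt, smul_sub, smul_wt, smul_wt]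

theorem refl_smul_rt (a : SimpleRoot n) : refl a • rt a = -rt a := by
  rw [smul_rt, refl_upper, refl_lower, rt, neg_sub]

/-- The product of the elements `x_i` along a word. -/
noncomputable def nilWord (l : List (SimpleRoot n)) : NilHecke n := (l.map nilHeckeGen).prod

/-- The coefficients of the product of the elements `x_i` along a word. -/
noncomputable def nilCoeff (l : List (SimpleRoot n)) (v : weylGroup n) : RatFun n :=
  (nilWord l).coeff v

theorem nilWord_cons (a : SimpleRoot n) (l : List (SimpleRoot n)) :
    nilWord (a :: l) = nilHeckeGen a * nilWord l := List.prod_cons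

theorem nilWord_append (l l' : List (SimpleRoot n)) :
    nilWord (l ++ l') = nilWord l * nilWord l' := by
  simp [nilWord]

theorem nilHeckeGen_eq (a : SimpleRoot n) : nilHeckeGen a =
    SkewMonoidAlgebra.single (refl a) (rt a)⁻¹ - SkewMonoidAlgebra.single 1 (rt a)⁻¹ := by
  rw [nilHeckeGen, algebraMap_rootPoly, smul_sub, SkewMonoidAlgebra.smul_single,
    SkewMonoidAlgebra.smul_single, smul_eq_mul, mul_one, refl]

open Classical in
theorem nilCoeff_nil (v : weylGroup n) : nilCoeff [] v = if v = 1 then 1 else 0 := by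
  rw [nilCoeff, nilWord, List.map_nil, List.prod_nil, SkewMonoidAlgebra.one_def,
    SkewMonoidAlgebra.coeff_single_apply]
  simp only [eq_comm]

theorem nilCoeff_cons (a : SimpleRoot n) (l : List (SimpleRoot n)) (v : weylGroup n) :
    nilCoeff (a :: l) v =
      (rt a)⁻¹ * (refl a • nilCoeff l (refl a * v) - nilCoeff l v) := by
  rw [nilCoeff, nilWord_cons, nilHeckeGen_eq, sub_mul, SkewMonoidAlgebra.coeff_sub,
    Finsupp.sub_apply, SkewMonoidAlgebra.coeff_single_mul, SkewMonoidAlgebra.coeff_single_mul,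
    refl_inv, one_smul, inv_one, one_mul, mul_sub, nilCoeff, nilCoeff]

noncomputable instance : Fintype (weylGroup n) := Fintype.ofFinite _

theorem nilCoeff_append (l l' : List (SimpleRoot n)) (v : weylGroup n) :
    nilCoeff (l ++ l') v = ∑ y : weylGroup n, nilCoeff l y * y • nilCoeff l' (y⁻¹ * v) := by
  rw [nilCoeff, nilWord_append, SkewMonoidAlgebra.coeff_mul_left, SkewMonoidAlgebra.sum_def']
  refine Finset.sum_subset (Finset.subset_univ _) fun y _ hy => ?_
  rw [SkewMonoidAlgebra.notMem_support_iff.mp hy, zero_mul]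

/-- Each factor is a combination of `δ_s` and `δ_id`, so expanding the product keeps or drops every
letter. All vanishing statements below come from this support bound. -/
theorem exists_sublist_of_nilCoeff_ne_zero {l : List (SimpleRoot n)} {v : weylGroup n}
    (h : nilCoeff l v ≠ 0) : ∃ l', l'.Sublist l ∧ wordProd l' = v := by
  induction l generalizing v with
  | nil =>
    classical
    rw [nilCoeff_nil, ite_ne_right_iff] at h
    exact ⟨[], List.Sublist.refl _, h.1.symm⟩
  | cons a l ih =>
    rw [nilCoeff_cons] at h
    by_cases h1 : nilCoeff l v = 0
    · by_cases h2 : nilCoeff l (refl a * v) = 0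
      · rw [h1, h2, smul_zero, sub_zero, mul_zero] at h
        exact absurd rfl h
      · obtain ⟨l', hl, hv⟩ := ih h2
        exact ⟨a :: l', hl.cons_cons a, by rw [wordProd_cons, hv, refl_mul_refl_mul]⟩
    · obtain ⟨l', hl, hv⟩ := ih h1
      exact ⟨l', hl.cons a, hv⟩

/-- If no proper subword of `l` has the same product, the coefficient at this product does not
vanish. -/
theorem nilCoeff_wordProd_ne_zero {l : List (SimpleRoot n)}
    (h : ∀ l', l'.Sublist l → wordProd l' = wordProd l → l' = l) :
    nilCoeff l (wordProd l) ≠ 0 := by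
  induction l with
  | nil =>
    classical
    rw [nilCoeff_nil, if_pos wordProd_nil]
    exact one_ne_zero
  | cons a l ih =>
    have h1 : nilCoeff l (wordProd (a :: l)) = 0 := by
      by_contra hc
      obtain ⟨l', hl, hv⟩ := exists_sublist_of_nilCoeff_ne_zero hc
      have := hl.length_le
      rw [h l' (hl.cons a) hv, List.length_cons] at this
      omega
    have h2 : nilCoeff l (wordProd l) ≠ 0 := by
      refine ih fun l' hl hv => ?_
      have := h (a :: l') (hl.cons_cons a) (by rw [wordProd_cons, hv, wordProd_cons])
      exact (List.cons.inj this).2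
    rw [nilCoeff_cons, h1, sub_zero, wordProd_cons, refl_mul_refl_mul]
    exact mul_ne_zero (inv_ne_zero (rt_ne_zero a)) ((smul_ne_zero_iff_ne _).mpr h2)

/-! ### Rank two relations and independence of the reduced word -/

/-- Two simple roots are orthogonal. -/
def IsOrthogonal (a b : SimpleRoot n) : Prop :=
  ((refl a).1 (upper b) = upper b ∧ (refl a).1 (lower b) = lower b) ∨
    ((refl a).1 (upper b) = (lower b).opp ∧ (refl a).1 (lower b) = (upper b).opp)

/-- The lower letter of `a` is the upper letter of `b`. -/
def IsLinked (a b : SimpleRoot n) : Prop := lower a = upper b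

theorem isOrthogonal_of_ne {a b : SimpleRoot n} (h1 : (upper a).1 ≠ (upper b).1)
    (h2 : ((upper a).1 : ℕ) + 1 ≠ (upper b).1) (h3 : ((upper b).1 : ℕ) + 1 ≠ (upper a).1) :
    IsOrthogonal a b := by
  have ha := lower_fst_val a
  have hb := lower_fst_val b
  have h1' : ((upper a).1 : ℕ) ≠ (upper b).1 := fun h => h1 (Fin.ext h)
  refine Or.inl ⟨refl_of_ne a (Ne.symm h1) ?_, refl_of_ne a ?_ ?_⟩ <;> rw [ne_eq, Fin.ext_iff] <;>
    omega

theorem isLinked_of_succ_eq {a b : SimpleRoot n} (h : ((upper a).1 : ℕ) + 1 = (upper b).1) :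
    IsLinked a b := by
  have ha := lower_fst_val a
  have hb := lower_fst_val b
  have hn := (lower b).1.2
  have h1 : (lower a).2 = 1 := a.2.2.resolve_right fun hc => by
    have hc : ((lower a).1 : ℕ) + 1 = n := hc
    omega
  exact Prod.ext (Fin.ext (by omega)) h1

/-- Distinct simple roots share their upper letter only at the fork of the diagram, where they are
`ε_p - ε_q` and `ε_p + ε_q`. -/
theorem eq_or_isOrthogonal {a b : SimpleRoot n} (h : (upper a).1 = (upper b).1) :
    a = b ∨ IsOrthogonal a b := by
  have ha := lower_fst_val a
  have hb := lower_fst_val b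
  have hu : upper b = upper a := Prod.ext h.symm rfl
  have hl : (lower b).1 = (lower a).1 := Fin.ext (by rw [ha, hb, h])
  rcases eq_or_eq_opp hl with h1 | h1
  · left
    have h2 : (lower b).2 = (lower a).2 := by rw [h1]
    exact Subtype.ext (Subtype.ext (Prod.ext h (Prod.ext hl.symm h2.symm)))
  · right
    right
    rw [hu, h1, opp_opp, apply_opp, refl_upper, refl_lower]
    exact ⟨rfl, rfl⟩

theorem simpleRoot_cases (a b : SimpleRoot n) : a = b ∨ IsLinked a b ∨ IsLinked b a ∨
    (IsOrthogonal a b ∧ IsOrthogonal b a) := by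
  by_cases h1 : (upper a).1 = (upper b).1
  · rcases eq_or_isOrthogonal h1 with h | h
    · exact Or.inl h
    · rcases eq_or_isOrthogonal h1.symm with h' | h'
      · exact Or.inl h'.symm
      · exact Or.inr (Or.inr (Or.inr ⟨h, h'⟩))
  · by_cases h2 : ((upper a).1 : ℕ) + 1 = (upper b).1
    · exact Or.inr (Or.inl (isLinked_of_succ_eq h2))
    · by_cases h3 : ((upper b).1 : ℕ) + 1 = (upper a).1
      · exact Or.inr (Or.inr (Or.inl (isLinked_of_succ_eq h3)))
      · exact Or.inr (Or.inr (Or.inr ⟨isOrthogonal_of_ne h1 h2 h3,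
          isOrthogonal_of_ne (Ne.symm h1) h3 h2⟩))

theorem IsOrthogonal.smul_rt {a b : SimpleRoot n} (h : IsOrthogonal a b) :
    refl a • rt b = rt b := by
  rw [TypeD.smul_rt, rt]
  rcases h with ⟨h1, h2⟩ | ⟨h1, h2⟩
  · rw [h1, h2]
  · rw [h1, h2, wt_opp, wt_opp]
    ring

theorem IsOrthogonal.isDescent {a b : SimpleRoot n} (h : IsOrthogonal a b) {w : weylGroup n}
    (hb : IsDescent w b) : IsDescent (refl a * w) b := by
  rw [IsDescent, mul_inv_rev, refl_inv, mul_apply, mul_apply]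
  rcases h with ⟨h1, h2⟩ | ⟨h1, h2⟩
  · rw [h1, h2]
    exact hb
  · rw [h1, h2, apply_opp, apply_opp, rhoVal_opp, rhoVal_opp, neg_lt_neg_iff]
    exact hb

/-- Conjugating a reflection: if `w α = ±β`, then `w s_α = s_β w`. -/
theorem mul_refl_eq {w : weylGroup n} {a b : SimpleRoot n}
    (h : (w.1 (upper a) = upper b ∧ w.1 (lower a) = lower b) ∨
      (w.1 (upper a) = (lower b).opp ∧ w.1 (lower a) = (upper b).opp)) :
    w * refl a = refl b * w := by
  apply ext_apply
  intro p
  rw [mul_apply, mul_apply]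
  by_cases h1 : p.1 = (upper a).1
  · rcases eq_or_eq_opp h1 with rfl | rfl
    · rw [refl_upper]
      rcases h with ⟨h2, h3⟩ | ⟨h2, h3⟩
      · rw [h2, h3, refl_upper]
      · rw [h2, h3, apply_opp, refl_lower]
    · rw [apply_opp, apply_opp, apply_opp, apply_opp, refl_upper]
      rcases h with ⟨h2, h3⟩ | ⟨h2, h3⟩
      · rw [h2, h3, refl_upper]
      · rw [h2, h3, apply_opp, refl_lower]
  · by_cases h1' : p.1 = (lower a).1
    · rcases eq_or_eq_opp h1' with rfl | rfl
      · rw [refl_lower]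
        rcases h with ⟨h2, h3⟩ | ⟨h2, h3⟩
        · rw [h2, h3, refl_lower]
        · rw [h2, h3, apply_opp, refl_upper]
      · rw [apply_opp, apply_opp, apply_opp, apply_opp, refl_lower]
        rcases h with ⟨h2, h3⟩ | ⟨h2, h3⟩
        · rw [h2, h3, refl_lower]
        · rw [h2, h3, apply_opp, refl_upper]
    · have h4 := apply_fst_ne w h1
      have h5 := apply_fst_ne w h1'
      rw [refl_of_ne a h1 h1', refl_of_ne]
      · rcases h with ⟨h2, h3⟩ | ⟨h2, h3⟩
        · rwa [h2] at h4
        · rwa [h3] at h5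
      · rcases h with ⟨h2, h3⟩ | ⟨h2, h3⟩
        · rwa [h3] at h5
        · rwa [h2] at h4

theorem IsOrthogonal.refl_comm {a b : SimpleRoot n} (h : IsOrthogonal a b) :
    refl a * refl b = refl b * refl a := mul_refl_eq h

theorem IsLinked.refl_apply {a b : SimpleRoot n} (h : IsLinked a b) :
    (refl a).1 (upper b) = upper a ∧ (refl a).1 (lower b) = lower b ∧
      (refl b).1 (upper a) = upper a ∧ (refl b).1 (lower a) = lower b := by
  have ha := lower_fst_val a
  have hb := lower_fst_val b
  have hf : ((lower a).1 : ℕ) = (upper b).1 := by rw [h]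
  refine ⟨by rw [← h, refl_lower], refl_of_ne _ ?_ ?_, refl_of_ne _ ?_ ?_, by rw [h, refl_upper]⟩ <;>
    rw [ne_eq, Fin.ext_iff] <;> omega

theorem IsLinked.braid {a b : SimpleRoot n} (h : IsLinked a b) :
    refl a * (refl b * refl a) = refl b * (refl a * refl b) := by
  obtain ⟨h1, h2, h3, h4⟩ := h.refl_apply
  rw [← mul_assoc, ← mul_assoc, mul_assoc (refl b)]
  rw [mul_refl_eq (b := b)]
  left
  rw [mul_apply, mul_apply, h3, h4, refl_upper, h2, h]
  exact ⟨rfl, rfl⟩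

theorem IsLinked.smul_rt {a b : SimpleRoot n} (h : IsLinked a b) :
    refl a • rt b = rt a + rt b ∧ refl b • rt a = rt a + rt b := by
  obtain ⟨h1, h2, h3, h4⟩ := h.refl_apply
  rw [TypeD.smul_rt, TypeD.smul_rt, h1, h2, h3, h4, rt, rt, h]
  constructor <;> ring

theorem IsLinked.rt_add_ne_zero {a b : SimpleRoot n} (h : IsLinked a b) : rt a + rt b ≠ 0 := by
  rw [← h.smul_rt.1]
  exact (smul_ne_zero_iff_ne _).mpr (rt_ne_zero b)

theorem IsOrthogonal.nilHeckeGen_comm {a b : SimpleRoot n} (h : IsOrthogonal a b)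
    (h' : IsOrthogonal b a) : nilHeckeGen a * nilHeckeGen b = nilHeckeGen b * nilHeckeGen a := by
  rw [nilHeckeGen_eq, nilHeckeGen_eq]
  simp only [sub_mul, mul_sub, SkewMonoidAlgebra.single_mul_single, smul_inv'', h.smul_rt,
    h'.smul_rt, one_mul, mul_one, one_smul, h.refl_comm, mul_comm (rt a)⁻¹]
  abel

theorem IsLinked.nilHeckeGen_braid {a b : SimpleRoot n} (h : IsLinked a b) :
    nilHeckeGen a * (nilHeckeGen b * nilHeckeGen a) =
      nilHeckeGen b * (nilHeckeGen a * nilHeckeGen b) := by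
  have ha := rt_ne_zero a
  have hb := rt_ne_zero b
  have hab := h.rt_add_ne_zero
  have hneg : ∀ c : SimpleRoot n, refl c • rt c = -rt c := refl_smul_rt
  have e : ∀ (v : weylGroup n) (f : RatFun n), (SkewMonoidAlgebra.single v f : NilHecke n) =
      f • SkewMonoidAlgebra.single v 1 := fun v f => by
    rw [SkewMonoidAlgebra.smul_single, smul_eq_mul, mul_one]
  rw [nilHeckeGen_eq, nilHeckeGen_eq]
  simp only [sub_mul, mul_sub, SkewMonoidAlgebra.single_mul_single, smul_inv'', smul_mul',
    smul_add, hneg, h.smul_rt.1, h.smul_rt.2, one_mul, mul_one, one_smul, refl_mul_self, h.braid,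
    neg_add_cancel_left, add_neg_cancel_right]
  refine SkewMonoidAlgebra.ext fun v => ?_
  simp only [e _ (_ * _), SkewMonoidAlgebra.coeff_sub, SkewMonoidAlgebra.coeff_smul,
    Finsupp.sub_apply, Finsupp.smul_apply, smul_eq_mul]
  field_simp
  ring

theorem IsReduced.cons {c : SimpleRoot n} {r : List (SimpleRoot n)} {u : weylGroup n}
    (hr : IsReduced r) (he : wordProd r = refl c * u) (hd : IsDescent u c) :
    IsReduced (c :: r) ∧ wordProd (c :: r) = u := by
  have h1 := hd.invCount_refl_mul
  have h2 : wordProd (c :: r) = u := by rw [wordProd_cons, he, refl_mul_refl_mul]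
  rw [IsReduced] at hr ⊢
  rw [h2, List.length_cons]
  rw [he] at hr
  exact ⟨by omega, rfl⟩

theorem exists_isReduced (w : weylGroup n) : ∃ t, IsReduced t ∧ wordProd t = w :=
  ⟨_, (isReduced_reducedDecomposition w).2, (isReduced_reducedDecomposition w).1⟩

theorem IsOrthogonal.exists_isReduced {a b : SimpleRoot n} (h : IsOrthogonal a b)
    (h' : IsOrthogonal b a) {w : weylGroup n} (ha : IsDescent w a) (hb : IsDescent w b) :
    ∃ t, IsReduced (b :: t) ∧ IsReduced (a :: t) ∧ wordProd (a :: b :: t) = w ∧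
      wordProd (b :: a :: t) = w := by
  obtain ⟨t, ht, he⟩ := TypeD.exists_isReduced (refl b * (refl a * w))
  have he' : wordProd t = refl a * (refl b * w) := by
    rw [he, ← mul_assoc, ← mul_assoc, h.refl_comm]
  obtain ⟨h1, h2⟩ := ht.cons he (h.isDescent hb)
  obtain ⟨h3, h4⟩ := ht.cons he' (h'.isDescent ha)
  exact ⟨t, h1, h3, by rw [wordProd_cons, h2, refl_mul_refl_mul],
    by rw [wordProd_cons, h4, refl_mul_refl_mul]⟩

/-- If both linked roots are left descents, the longest element of the rank two subgroup they
generate splits off on the left, and its two reduced words share the remainder `t`. -/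
theorem IsLinked.exists_isReduced {a b : SimpleRoot n} (h : IsLinked a b) {w : weylGroup n}
    (ha : IsDescent w a) (hb : IsDescent w b) :
    ∃ t, IsReduced (b :: a :: t) ∧ IsReduced (a :: b :: t) ∧ wordProd (a :: b :: a :: t) = w ∧
      wordProd (b :: a :: b :: t) = w := by
  obtain ⟨h1, h2, h3, h4⟩ := h.refl_apply
  have hlt : rhoVal (w⁻¹.1 (upper a)) < rhoVal (w⁻¹.1 (lower b)) :=
    lt_trans ha ((congrArg (fun p => rhoVal (w⁻¹.1 p)) h).trans_lt hb)
  have hs : ∀ (c : SimpleRoot n) (u : weylGroup n) (p : Letter n),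
      (refl c * u)⁻¹.1 p = u⁻¹.1 ((refl c).1 p) := fun c u p => by
    rw [mul_inv_rev, refl_inv, mul_apply]
  have d1 : IsDescent (refl a * w) b := by
    rw [IsDescent, hs, hs, h1, h2]
    exact hlt
  have d2 : IsDescent (refl b * (refl a * w)) a := by
    rw [IsDescent, hs, hs, hs, hs, h3, h4, refl_upper, h2, h]
    exact hb
  have d1' : IsDescent (refl b * w) a := by
    rw [IsDescent, hs, hs, h3, h4]
    exact hlt
  have d2' : IsDescent (refl a * (refl b * w)) b := by
    rw [IsDescent, hs, hs, hs, hs, h1, h2, h3, refl_lower, ← h]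
    exact ha
  obtain ⟨t, ht, he⟩ := TypeD.exists_isReduced (refl a * (refl b * (refl a * w)))
  have he' : wordProd t = refl b * (refl a * (refl b * w)) := by
    rw [he]
    simpa only [mul_assoc] using congrArg (· * w) h.braid
  obtain ⟨r1, e1⟩ := ht.cons he d2
  obtain ⟨r2, e2⟩ := r1.cons e1 d1
  obtain ⟨r1', e1'⟩ := ht.cons he' d2'
  obtain ⟨r2', e2'⟩ := r1'.cons e1' d1'
  exact ⟨t, r2, r2', by rw [wordProd_cons, e2, refl_mul_refl_mul],
    by rw [wordProd_cons, e2', refl_mul_refl_mul]⟩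

theorem IsLinked.nilWord_eq {a b : SimpleRoot n} (h : IsLinked a b) (t : List (SimpleRoot n)) :
    nilWord (a :: b :: a :: t) = nilWord (b :: a :: b :: t) := by
  simpa only [nilWord_cons, mul_assoc] using congrArg (· * nilWord t) h.nilHeckeGen_braid

/-- Two reduced words of the same element give the same product of the elements `x_i`. -/
theorem nilWord_eq_of_wordProd_eq {l l' : List (SimpleRoot n)} (hl : IsReduced l)
    (hl' : IsReduced l') (h : wordProd l = wordProd l') : nilWord l = nilWord l' := by
  induction hm : l.length using Nat.strong_induction_on generalizing l l' with
  | _ m ih =>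
    subst hm
    have hlen : l.length = l'.length := by
      rw [IsReduced] at hl hl'
      rw [h] at hl
      omega
    -- Words with a common first letter are handled by the induction hypothesis. Different first
    -- letters are then joined through words that begin with the two sides of a commutation or braid
    -- relation.
    have key : ∀ (c : SimpleRoot n) (r r' : List (SimpleRoot n)), IsReduced (c :: r) →
        r.length < l.length → IsReduced r' → wordProd (c :: r) = wordProd (c :: r') →
        nilWord (c :: r) = nilWord (c :: r') := by
      intro c r r' hr hlt hr' he
      rw [wordProd_cons, wordProd_cons, mul_right_inj] at he
      rw [nilWord_cons, nilWord_cons, ih _ hlt hr.of_cons.1 hr' he rfl]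
    match l, l', hlen with
    | [], [], _ => rfl
    | a :: r, b :: r', hlen =>
      have hlt : r.length < (a :: r).length := by simp
      have hlt' : r'.length < (a :: r).length := by rw [hlen]; simp
      have hda := hl.of_cons.2
      have hdb := hl'.of_cons.2
      rw [← h] at hdb
      rcases simpleRoot_cases a b with rfl | hab | hab | ⟨hab, hba⟩
      · exact key a r r' hl hlt hl'.of_cons.1 h
      · obtain ⟨t, h1, h2, h3, h4⟩ := hab.exists_isReduced hda hdb
        rw [key a r _ hl hlt h1 h3.symm, key b r' _ hl' hlt' h2 (h.symm.trans h4.symm),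
          hab.nilWord_eq]
      · obtain ⟨t, h1, h2, h3, h4⟩ := hab.exists_isReduced hdb hda
        rw [key a r _ hl hlt h2 h4.symm, key b r' _ hl' hlt' h1 (h.symm.trans h3.symm),
          hab.nilWord_eq]
      · obtain ⟨t, h1, h2, h3, h4⟩ := hab.exists_isReduced hba hda hdb
        rw [key a r _ hl hlt h1 h3.symm, key b r' _ hl' hlt' h2 (h.symm.trans h4.symm)]
        simp only [nilWord_cons, ← mul_assoc, hab.nilHeckeGen_comm hba]

/-- The definition uses an arbitrarily chosen reduced word; this allows a word adapted to the
involution instead. -/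
theorem nilHeckeCoeff_eq {l : List (SimpleRoot n)} (hl : IsReduced l) (v : weylGroup n) :
    nilHeckeCoeff (wordProd l) v = nilCoeff l v := by
  obtain ⟨h1, h2⟩ := isReduced_reducedDecomposition (wordProd l)
  rw [nilCoeff, ← nilWord_eq_of_wordProd_eq h2 hl h1]
  rfl

/-! ### Translation in one variable and partial fractions -/

/-- The translation `ε_k ↦ ε_k + 1` of `ℂ[𝔥]`. -/
noncomputable def polyShift (k : Fin n) : Poly n ≃ₐ[ℂ] Poly n :=
  AlgEquiv.ofAlgHom
    (MvPolynomial.aeval fun i => MvPolynomial.X i + if i = k then 1 else 0)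
    (MvPolynomial.aeval fun i => MvPolynomial.X i - if i = k then 1 else 0)
    (by ext i; by_cases h : i = k <;> simp [h])
    (by ext i; by_cases h : i = k <;> simp [h])

/-- The translation `ε_k ↦ ε_k + 1` of `ℂ(𝔥)`. -/
noncomputable def shift (k : Fin n) : RatFun n ≃+* RatFun n :=
  IsFractionRing.ringEquivOfRingEquiv (polyShift k).toRingEquiv

theorem shift_algebraMap (k : Fin n) (f : Poly n) :
    shift k (algebraMap (Poly n) (RatFun n) f) = algebraMap (Poly n) (RatFun n) (polyShift k f) :=
  IsFractionRing.ringEquivOfRingEquiv_algebraMap _ f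

theorem polyShift_X (k i : Fin n) : polyShift k (MvPolynomial.X i) =
    MvPolynomial.X i + if i = k then 1 else 0 := by
  simp [polyShift]

theorem weight_one (i : Fin n) : weight (i, 1) = (MvPolynomial.X i : Poly n) := by
  simp [weight]

theorem shift_wt_one (k i : Fin n) : shift k (wt (i, 1)) = wt (i, 1) + if i = k then 1 else 0 := by
  rw [wt, shift_algebraMap, weight_one, polyShift_X, map_add]
  split_ifs <;> simp

theorem shift_wt {k : Fin n} {p : Letter n} (h : p.1 ≠ k) : shift k (wt p) = wt p := by
  obtain ⟨i, e⟩ := p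
  have h1 : shift k (wt (i, 1)) = wt (i, 1) := by rw [shift_wt_one, if_neg h, add_zero]
  rcases eq_or_eq_opp (p := (i, e)) (q := (i, 1)) rfl with h2 | h2
  · rw [h2, h1]
  · rw [h2, wt_opp, map_neg, h1]

theorem smul_algebraMap_C (w : weylGroup n) (r : ℂ) :
    w • algebraMap (Poly n) (RatFun n) (MvPolynomial.C r) =
      algebraMap (Poly n) (RatFun n) (MvPolynomial.C r) := by
  rw [smul_algebraMap]
  congr 1
  exact MvPolynomial.aeval_C _ r

/-- Invariance under `shift k` serves as the meaning of "free of `ε_k`". Elements of `W` that fix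
`k` commute with the translation, since this holds on constants and variables, and so they preserve
this property. -/
theorem shift_smul {k : Fin n} {w : weylGroup n} (h : w.1 (k, 1) = (k, 1)) (F : RatFun n) :
    shift k (w • F) = w • shift k F := by
  have key : ((shift k : RatFun n →+* RatFun n).comp (MulSemiringAction.toRingHom _ _ w)) =
      (MulSemiringAction.toRingHom _ _ w).comp (shift k : RatFun n →+* RatFun n) := by
    refine IsLocalization.ringHom_ext (nonZeroDivisors (Poly n)) ?_
    refine MvPolynomial.ringHom_ext (fun r => ?_) (fun i => ?_)
    · have h1 : shift k (algebraMap (Poly n) (RatFun n) (MvPolynomial.C r)) =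
          algebraMap (Poly n) (RatFun n) (MvPolynomial.C r) := by
        rw [shift_algebraMap]
        congr 1
        exact (polyShift k).commutes r
      change shift k (w • algebraMap (Poly n) (RatFun n) (MvPolynomial.C r)) =
        w • shift k (algebraMap (Poly n) (RatFun n) (MvPolynomial.C r))
      rw [smul_algebraMap_C, h1, smul_algebraMap_C]
    · change shift k (w • algebraMap (Poly n) (RatFun n) (MvPolynomial.X i)) =
        w • shift k (algebraMap (Poly n) (RatFun n) (MvPolynomial.X i))
      rw [← weight_one]
      change shift k (w • wt (i, 1)) = w • shift k (wt (i, 1))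
      by_cases hi : i = k
      · subst hi
        rw [smul_wt, h, shift_wt_one, if_pos rfl, smul_add, smul_wt, h, smul_one]
      · have h2 : (w.1 (i, 1)).1 ≠ k := by
          have := apply_fst_ne w (p := (i, 1)) (q := (k, 1)) hi
          rwa [h] at this
        rw [smul_wt, shift_wt h2, shift_wt hi, smul_wt]
  exact congrArg (fun f : RatFun n →+* RatFun n => f F) key

theorem iterate_shift_wt (k : Fin n) (m : ℕ) : (shift k)^[m] (wt (k, 1)) = wt (k, 1) + m := by
  induction m with
  | zero => simp
  | succ m ih =>
    rw [Function.iterate_succ_apply', ih, map_add, map_natCast, shift_wt_one, if_pos rfl]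
    push_cast
    ring

theorem iterate_shift_of_fixed {k : Fin n} {F : RatFun n} (h : shift k F = F) (m : ℕ) :
    (shift k)^[m] F = F := Function.iterate_fixed h m

/-- Uniqueness of partial fraction decompositions with respect to `ε_k`. -/
theorem partialFraction_unique {k : Fin n} {F : RatFun n} {H : Letter n → RatFun n}
    (hF : shift k F = F) (hH : ∀ m, shift k (H m) = H m)
    (h : F = ∑ m with m.1 ≠ k, H m / (wt (k, 1) - wt m)) {m : Letter n} (hm : m.1 ≠ k) :
    H m = 0 := by
  classical
  set S : Finset (Letter n) := Finset.univ.filter fun m => m.1 ≠ k with hS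
  have hmem : ∀ q, q ∈ S ↔ q.1 ≠ k := fun q => by simp [hS]
  -- The identity with denominators cleared and `ε_k` replaced by an indeterminate.
  let P : Polynomial (RatFun n) :=
    Polynomial.C F * ∏ q ∈ S, (Polynomial.X - Polynomial.C (wt q)) -
      ∑ q ∈ S, Polynomial.C (H q) * ∏ r ∈ S.erase q, (Polynomial.X - Polynomial.C (wt r))
  -- Applying the translation `i` times to `h` moves only `ε_k`, so `ε_k + i` is a root for every
  -- natural `i`; infinitely many roots force `P = 0`.
  have hroot : ∀ i : ℕ, P.eval (wt (k, 1) + i) = 0 := by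
    intro i
    have hd : ∀ q ∈ S, (wt (k, 1) : RatFun n) + i - wt q =
        (shift k)^[i] (wt (k, 1) - wt q) := by
      intro q hq
      rw [← RingEquiv.coe_toRingHom, ← RingHom.coe_pow, map_sub, RingHom.coe_pow,
        RingEquiv.coe_toRingHom, iterate_shift_wt,
        iterate_shift_of_fixed (shift_wt ((hmem q).mp hq))]
    have hne : ∀ q ∈ S, (wt (k, 1) : RatFun n) + i - wt q ≠ 0 := by
      intro q hq h0
      rw [hd q hq, ← RingEquiv.coe_toRingHom, ← RingHom.coe_pow, map_eq_zero] at h0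
      exact wt_sub_ne_zero (fun hc => (hmem q).mp hq (congrArg Prod.fst hc).symm) h0
    have hFi : F = ∑ q ∈ S, H q / (wt (k, 1) + i - wt q) := by
      have := congrArg ((shift k)^[i]) h
      rw [iterate_shift_of_fixed hF, ← RingEquiv.coe_toRingHom, ← RingHom.coe_pow, map_sum] at this
      rw [this]
      refine Finset.sum_congr rfl fun q hq => ?_
      rw [map_div₀, RingHom.coe_pow, RingEquiv.coe_toRingHom, iterate_shift_of_fixed (hH q),
        hd q hq]
    simp only [P, Polynomial.eval_sub, Polynomial.eval_mul, Polynomial.eval_C,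
      Polynomial.eval_finsetSum, Polynomial.eval_prod, Polynomial.eval_X]
    rw [sub_eq_zero]
    conv_lhs => rw [hFi, Finset.sum_mul]
    refine Finset.sum_congr rfl fun q hq => ?_
    rw [← Finset.mul_prod_erase S _ hq, ← mul_assoc, div_mul_cancel₀ _ (hne q hq)]
  have hP : P = 0 := by
    refine Polynomial.eq_zero_of_infinite_isRoot P ?_
    refine Set.infinite_of_injective_forall_mem (f := fun i : ℕ => (wt (k, 1) : RatFun n) + i)
      (fun i j hij => ?_) hroot
    exact Nat.cast_injective (add_left_cancel hij)
  -- At `ε_m` every term but the one of `m` contains a vanishing factor, and the product left beside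
  -- `H m` is nonzero.
  have heval := congrArg (Polynomial.eval (wt m)) hP
  have hmS : m ∈ S := (hmem m).mpr hm
  simp only [P, Polynomial.eval_sub, Polynomial.eval_mul, Polynomial.eval_C,
      Polynomial.eval_finsetSum, Polynomial.eval_prod, Polynomial.eval_X,
      Polynomial.eval_zero] at heval
  rw [Finset.prod_eq_zero hmS (sub_self _), mul_zero, zero_sub, neg_eq_zero,
    Finset.sum_eq_single_of_mem m hmS] at heval
  · refine (mul_eq_zero.mp heval).resolve_right (Finset.prod_ne_zero_iff.mpr fun r hr => ?_)
    exact wt_sub_ne_zero (Finset.ne_of_mem_erase hr).symm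
  · intro q _ hq
    rw [Finset.prod_eq_zero (Finset.mem_erase.mpr ⟨hq.symm, hmS⟩) (sub_self _), mul_zero]

/-! ### Elements fixing the first letters -/

/-- `w` fixes the first `K` letters and their opposites. -/
def FixesBelow (K : ℕ) (w : weylGroup n) : Prop := ∀ p : Letter n, (p.1 : ℕ) < K → w.1 p = p

theorem FixesBelow.mul {K : ℕ} {v w : weylGroup n} (hv : FixesBelow K v) (hw : FixesBelow K w) :
    FixesBelow K (v * w) := fun p hp => by rw [mul_apply, hw p hp, hv p hp]

theorem FixesBelow.inv {K : ℕ} {w : weylGroup n} (hw : FixesBelow K w) : FixesBelow K w⁻¹ :=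
  fun p hp => by
    conv_lhs => rw [← hw p hp]
    exact inv_apply_apply w p

theorem FixesBelow.le_fst {K : ℕ} {w : weylGroup n} (hw : FixesBelow K w) {p : Letter n}
    (hp : K ≤ p.1) : K ≤ (w.1 p).1 := by
  by_contra! h
  have h1 : w.1 p = p := w.1.injective (hw _ h)
  rw [h1] at h
  omega

theorem fixesBelow_refl {K : ℕ} {a : SimpleRoot n} (h : K ≤ (upper a).1) :
    FixesBelow K (refl a) := by
  intro p hp
  have := lower_fst_val a
  refine refl_of_ne a ?_ ?_ <;> rw [ne_eq, Fin.ext_iff] <;> omega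

theorem fixesBelow_wordProd {K : ℕ} {l : List (SimpleRoot n)}
    (h : ∀ a ∈ l, K ≤ ((upper a).1 : ℕ)) : FixesBelow K (wordProd l) := by
  induction l with
  | nil => exact fun p _ => rfl
  | cons a l ih =>
    rw [wordProd_cons]
    exact (fixesBelow_refl (h a (by simp))).mul (ih fun b hb => h b (by simp [hb]))

/-- The reduced words of an element of a standard parabolic subgroup lie in this subgroup. -/
theorem IsReduced.le_upper {K : ℕ} {l : List (SimpleRoot n)} (hl : IsReduced l)
    (h : FixesBelow K (wordProd l)) : ∀ a ∈ l, K ≤ ((upper a).1 : ℕ) := by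
  induction l with
  | nil => simp
  | cons a l ih =>
    have ha : K ≤ ((upper a).1 : ℕ) := by
      by_contra! hlt
      have hd := hl.of_cons.2
      have hf := h.inv
      rw [IsDescent] at hd
      generalize (wordProd (a :: l))⁻¹ = v at hf hd
      rw [hf _ hlt] at hd
      have hfst := lower_fst_val a
      -- The upper letter is fixed, while the lower one goes to a larger index and hence to a
      -- smaller height. This contradicts that `a` is a descent.
      have hle : ((upper a).1 : ℕ) + 1 ≤ (v.1 (lower a)).1 := by
        by_cases hlow : ((lower a).1 : ℕ) < K
        · rw [hf _ hlow, hfst]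
        · have := hf.le_fst (not_lt.mp hlow)
          omega
      have hn := (v.1 (lower a)).1.2
      have hrho : rhoVal (upper a) = n - 1 - ((upper a).1 : ℕ) := by simp [rhoVal, upper]
      have hrho' : rhoVal (v.1 (lower a)) ≤ n - 1 - ((v.1 (lower a)).1 : ℕ) := by
        rw [rhoVal]
        rcases Int.units_eq_one_or (v.1 (lower a)).2 with h | h <;> rw [h] <;> simp; omega
      omega
    intro b hb
    rcases List.mem_cons.mp hb with rfl | hb
    · exact ha
    · refine ih hl.of_cons.1 ?_ b hb
      rw [wordProd_cons] at h
      rw [← refl_mul_refl_mul a (wordProd l)]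
      exact (fixesBelow_refl ha).mul h

/-! ### Shortest paths between letters -/

theorem rhoVal_le_wordProd (l : List (SimpleRoot n)) (p : Letter n) :
    rhoVal p ≤ rhoVal ((wordProd l).1 p) + l.length := by
  induction l with
  | nil => simp [wordProd_nil]
  | cons a l ih =>
    rw [wordProd_cons, mul_apply, List.length_cons]
    have := rhoVal_le_refl a ((wordProd l).1 p)
    push_cast
    linarith

theorem rhoVal_lt_of_le {k : Fin n} (hk : (k : ℕ) + 1 < n) {p : Letter n} (h : (k : ℕ) ≤ p.1)
    (hp : p ≠ (k, 1)) : rhoVal p < rhoVal (k, 1) := by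
  obtain ⟨i, e⟩ := p
  have hi := i.2
  simp only [rhoVal, ne_eq, Prod.mk.injEq, Fin.ext_iff] at h hp ⊢
  rcases Int.units_eq_one_or e with rfl | rfl <;> simp at hp ⊢ <;> omega

/-- The word `A` is a shortest path, in the parabolic subgroup fixing the letter `k`, from a letter
`q` such that `ε_k - ε_q` is the simple root `a₀`, to the letter `j`. -/
structure IsPath (k : Fin n) (a₀ : SimpleRoot n) (A : List (SimpleRoot n)) (j : Letter n) :
    Prop where
  upper_eq : upper a₀ = (k, 1)
  lt_upper : ∀ a ∈ A, (k : ℕ) + 1 ≤ (upper a).1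
  apply_lower : (wordProd A).1 (lower a₀) = j
  rhoVal_add : rhoVal j + A.length = rhoVal (lower a₀)

theorem IsPath.lower_fst {k : Fin n} {a₀ : SimpleRoot n} {A : List (SimpleRoot n)} {j : Letter n}
    (h : IsPath k a₀ A j) : ((lower a₀).1 : ℕ) = k + 1 := by
  rw [lower_fst_val, h.upper_eq]

/-- Climb from `j` one unit of height at a time along `-i → -(i + 1)`, then from the opposite of the
last letter to the letter before the last, then `i → i - 1`, until `ε_k - ε_j` is simple. -/
theorem exists_isPath {k : Fin n} {j : Letter n} (h : (k : ℕ) < j.1) :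
    ∃ a₀ A, IsPath k a₀ A j := by
  induction hd : ((n : ℤ) - rhoVal j).toNat using Nat.strong_induction_on generalizing j with
  | _ d ih =>
    subst hd
    have step : ∀ (a : SimpleRoot n) (j' : Letter n), (k : ℕ) + 1 ≤ (upper a).1 →
        (refl a).1 j' = j → rhoVal j' = rhoVal j + 1 → (∃ a₀ A, IsPath k a₀ A j') →
        ∃ a₀ A, IsPath k a₀ A j := by
      rintro a j' ha hj hrho ⟨a₀, A, h1, h2, h3, h4⟩
      refine ⟨a₀, a :: A, h1, ?_, ?_, ?_⟩
      · intro b hb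
        rcases List.mem_cons.mp hb with rfl | hb
        · exact ha
        · exact h2 b hb
      · rw [wordProd_cons, mul_apply, h3, hj]
      · rw [List.length_cons]
        push_cast
        linarith
    obtain ⟨i, e⟩ := j
    have hi := i.2
    have h : (k : ℕ) < i := h
    -- The path is empty when `ε_k - ε_j` is already simple; a negative `j` is possible here only if
    -- it is the opposite of the last letter.
    by_cases hbase : (k : ℕ) + 1 = i ∧ (e = 1 ∨ (i : ℕ) + 1 = n)
    · exact ⟨⟨⟨(k, i, e), h⟩, hbase⟩, [], rfl, by simp, rfl, by simp [lower]⟩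
    rcases Int.units_eq_one_or e with rfl | rfl
    · have hlt : (k : ℕ) + 1 < i := by
        simp at hbase
        omega
      let i' : Fin n := ⟨i - 1, by omega⟩
      have hi' : (i' : ℕ) + 1 = i := by simp only [i']; omega
      have hrho : rhoVal (i', 1) = rhoVal (i, 1) + 1 := by
        simp [rhoVal]; omega
      have hle : rhoVal (i', 1) ≤ n := by simp [rhoVal]; omega
      exact step ⟨⟨(i', i, 1), show i' < i from Fin.lt_def.mpr (by omega)⟩, hi', Or.inl rfl⟩ (i', 1)
        (show (k : ℕ) + 1 ≤ i' by omega) (refl_upper _) hrho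
        (ih _ (by omega) (j := (i', 1)) (show (k : ℕ) < i' by omega) rfl)
    · by_cases hlast : (i : ℕ) + 1 = n
      · have hlt : (k : ℕ) + 1 < i := by
          simp [hlast] at hbase
          omega
        let i' : Fin n := ⟨i - 1, by omega⟩
        have hi' : (i' : ℕ) + 1 = i := by simp only [i']; omega
        have hrho : rhoVal (i', 1) = rhoVal (i, -1) + 1 := by
          simp [rhoVal]; omega
        have hle : rhoVal (i', 1) ≤ n := by simp [rhoVal]; omega
        exact step ⟨⟨(i', i, -1), show i' < i from Fin.lt_def.mpr (by omega)⟩, hi', Or.inr hlast⟩ (i', 1)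
          (show (k : ℕ) + 1 ≤ i' by omega) (refl_upper _) hrho
          (ih _ (by omega) (j := (i', 1)) (show (k : ℕ) < i' by omega) rfl)
      · let i' : Fin n := ⟨i + 1, by omega⟩
        have hi' : (i : ℕ) + 1 = i' := rfl
        have hrho : rhoVal (i', -1) = rhoVal (i, -1) + 1 := by
          simp [rhoVal]; omega
        have hle : rhoVal (i', -1) ≤ n := by simp [rhoVal]; omega
        refine step ⟨⟨(i, i', 1), show i < i' from Fin.lt_def.mpr (by omega)⟩, hi', Or.inl rfl⟩ (i', -1)
          (show (k : ℕ) + 1 ≤ i by omega) ?_ hrho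
          (ih _ (by omega) (j := (i', -1)) (show (k : ℕ) < i' by omega) rfl)
        exact (apply_opp _ (lower _)).trans (congrArg Letter.opp (refl_lower _))

/-! ### Factorization of basic involutions -/

/-- An involution `w` with `w(p) ≠ -p` for all letters `p`. -/
structure IsBasic (w : weylGroup n) : Prop where
  mul_self : w * w = 1
  apply_ne : ∀ p : Letter n, w.1 p ≠ p.opp

theorem IsBasicInvolution.isBasic {w : weylGroup n} (h : IsBasicInvolution w) : IsBasic w := by
  refine ⟨by rw [← sq, h.1], fun p hp => ?_⟩
  rcases eq_or_eq_opp (p := p) (q := (p.1, 1)) rfl with h1 | h1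
  · rw [h1] at hp
    exact h.2 p.1 hp
  · rw [h1, apply_opp, opp_opp] at hp
    have h2 : w.1 (p.1, 1) = Letter.opp (p.1, 1) := by rw [← hp, opp_opp, hp]
    exact h.2 p.1 h2

theorem IsBasic.inv_eq {w : weylGroup n} (h : IsBasic w) : w⁻¹ = w :=
  inv_eq_of_mul_eq_one_left h.mul_self

theorem IsBasic.apply_apply {w : weylGroup n} (h : IsBasic w) (p : Letter n) :
    w.1 (w.1 p) = p := by
  rw [← mul_apply, h.mul_self, one_apply]

theorem IsBasic.conj {w : weylGroup n} (h : IsBasic w) (a : SimpleRoot n) :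
    IsBasic (refl a * w * refl a) := by
  refine ⟨?_, fun p hp => ?_⟩
  · rw [mul_assoc, ← mul_assoc (refl a), ← mul_assoc (refl a), refl_mul_self, one_mul,
      mul_assoc (refl a), ← mul_assoc w, h.mul_self, one_mul, refl_mul_self]
  · rw [mul_apply, mul_apply] at hp
    have h1 := congrArg (refl a).1 hp
    rw [← mul_apply, refl_mul_self, one_apply, apply_opp] at h1
    exact h.apply_ne _ h1

/-- The letter `k` is the highest among the letters of index at least `k`, and its opposite is the
lowest, so `u⁻¹` makes the root negative. -/
theorem isDescent_of_inv_apply {k : Fin n} {u : weylGroup n} {a : SimpleRoot n}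
    (hu : FixesBelow k u) (ha : (k : ℕ) + 1 ≤ (upper a).1)
    (h : u⁻¹.1 (lower a) = (k, 1) ∨ u⁻¹.1 (upper a) = Letter.opp (k, 1)) : IsDescent u a := by
  have hfst := lower_fst_val a
  have hn := (lower a).1.2
  have hne := upper_ne_lower a
  rw [IsDescent]
  rcases h with h | h
  · rw [h]
    refine rhoVal_lt_of_le (by omega) (hu.inv.le_fst (by omega)) fun hc => ?_
    exact hne (u⁻¹.1.injective (hc.trans h.symm))
  · rw [h, rhoVal_opp, neg_lt, ← rhoVal_opp, ← apply_opp]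
    refine rhoVal_lt_of_le (by omega) (hu.inv.le_fst (by rw [opp_fst]; omega)) fun hc => ?_
    rw [apply_opp] at hc
    have h1 : u⁻¹.1 (lower a) = u⁻¹.1 (upper a) := by rw [h, ← hc, opp_opp]
    exact hne (u⁻¹.1.injective h1).symm

/-- Raising `w(k)` by `a` makes `a` a left descent of `w` and then a right descent of `refl a * w`,
so conjugation shortens `w` by two. -/
theorem IsBasic.invCount_conj {w : weylGroup n} (hw : IsBasic w) {k : Fin n}
    (hk : FixesBelow k w) {a : SimpleRoot n} (ha : (k : ℕ) + 1 ≤ (upper a).1)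
    (h : rhoVal (w.1 (k, 1)) < rhoVal ((refl a).1 (w.1 (k, 1)))) :
    invCount (refl a * w * refl a) + 4 = invCount w := by
  have hrf : FixesBelow (k + 1) (refl a) := fixesBelow_refl ha
  have hup := rhoVal_lower_lt_upper a
  have hcases : w.1 (k, 1) = lower a ∨ w.1 (k, 1) = (upper a).opp := by
    by_cases h1 : (w.1 (k, 1)).1 = (upper a).1
    · rcases eq_or_eq_opp h1 with h2 | h2
      · rw [h2, refl_upper] at h
        omega
      · exact Or.inr h2
    · by_cases h1' : (w.1 (k, 1)).1 = (lower a).1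
      · rcases eq_or_eq_opp h1' with h2 | h2
        · exact Or.inl h2
        · rw [h2, apply_opp, refl_lower, rhoVal_opp, rhoVal_opp] at h
          omega
      · rw [refl_of_ne a h1 h1'] at h
        omega
  have hcases' : w.1 (lower a) = (k, 1) ∨ w.1 (upper a) = Letter.opp (k, 1) := by
    rcases hcases with h1 | h1
    · exact Or.inl (by rw [← h1, hw.apply_apply])
    · exact Or.inr (by rw [← hw.apply_apply (k, 1), h1, apply_opp, opp_opp])
  have d1 : IsDescent w a := isDescent_of_inv_apply hk ha (by rwa [hw.inv_eq])
  have d2 : IsDescent (refl a * w)⁻¹ a := by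
    refine isDescent_of_inv_apply (k := k) ?_ ha ?_
    · exact (FixesBelow.mul (fun p hp => hrf p (by omega)) hk).inv
    · rw [inv_inv, mul_apply, mul_apply]
      rcases hcases' with h1 | h1
      · exact Or.inl (by rw [h1, hrf _ (Nat.lt_succ_self _)])
      · exact Or.inr (by rw [h1, hrf _ (Nat.lt_succ_self _)])
  have e1 := d1.invCount_refl_mul
  have e2 := d2.invCount_refl_mul
  rw [invCount_inv, mul_inv_rev, refl_inv, hw.inv_eq, ← mul_assoc] at e2
  omega

theorem IsPath.of_cons {k : Fin n} {a₀ a : SimpleRoot n} {A : List (SimpleRoot n)} {j : Letter n}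
    (h : IsPath k a₀ (a :: A) j) : IsPath k a₀ A ((refl a).1 j) ∧
      rhoVal j < rhoVal ((refl a).1 j) := by
  obtain ⟨h1, h2, h3, h4⟩ := h
  have hj : (wordProd A).1 (lower a₀) = (refl a).1 j := by
    rw [← h3, wordProd_cons, mul_apply, ← mul_apply (refl a), refl_mul_self, one_apply]
  have h5 := rhoVal_le_wordProd A (lower a₀)
  have h6 := rhoVal_le_refl a ((refl a).1 j)
  rw [← mul_apply, refl_mul_self, one_apply] at h6
  rw [hj] at h5
  rw [List.length_cons] at h4
  push_cast at h4
  exact ⟨⟨h1, fun b hb => h2 b (by simp [hb]), hj, by omega⟩, by omega⟩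

/-- The factorization of a basic involution `w` with `w(k) = j` along a path to `j`. -/
theorem IsPath.exists_factorization {k : Fin n} {a₀ : SimpleRoot n} {A : List (SimpleRoot n)}
    {j : Letter n} (h : IsPath k a₀ A j) {w : weylGroup n} (hw : IsBasic w)
    (hk : FixesBelow k w) (hj : w.1 (k, 1) = j) :
    ∃ b, FixesBelow (k + 2) b ∧ IsBasic b ∧
      w = wordProd A * b * refl a₀ * (wordProd A)⁻¹ ∧
      invCount w = 4 * A.length + 2 + invCount b := by
  induction A generalizing j w with
  | nil =>
    have hu := h.upper_eq
    have hj' : w.1 (upper a₀) = lower a₀ := by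
      have := h.apply_lower
      rw [wordProd_nil, one_apply] at this
      rw [hu, hj, this]
    have hj'' : w.1 (lower a₀) = upper a₀ := by rw [← hj', hw.apply_apply]
    -- With an empty path `w` swaps the two letters of `a₀`; removing this swap leaves an element
    -- that fixes both and commutes with it.
    set b := refl a₀ * w with hb
    have hwb : w = refl a₀ * b := by rw [hb, refl_mul_refl_mul]
    have hbu : b.1 (upper a₀) = upper a₀ := by rw [hb, mul_apply, hj', refl_lower]
    have hbl : b.1 (lower a₀) = lower a₀ := by rw [hb, mul_apply, hj'', refl_upper]
    have hcomm : b * refl a₀ = refl a₀ * b := mul_refl_eq (Or.inl ⟨hbu, hbl⟩)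
    have hfst := h.lower_fst
    have hfix : FixesBelow (k + 2) b := by
      intro p hp
      by_cases hpk : (p.1 : ℕ) < k
      · refine FixesBelow.mul (fixesBelow_refl ?_) hk p hpk
        rw [hu]
      · by_cases hpk' : (p.1 : ℕ) = k
        · have : p.1 = (upper a₀).1 := by rw [hu]; exact Fin.ext hpk'
          rcases eq_or_eq_opp this with rfl | rfl
          · exact hbu
          · rw [apply_opp, hbu]
        · have : p.1 = (lower a₀).1 := Fin.ext (by omega)
          rcases eq_or_eq_opp this with rfl | rfl
          · exact hbl
          · rw [apply_opp, hbl]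
    refine ⟨b, hfix, ⟨?_, fun p hp => ?_⟩, ?_, ?_⟩
    · have h1 := hw.mul_self
      rw [hwb] at h1
      nth_rewrite 1 [← hcomm] at h1
      rwa [mul_assoc, refl_mul_refl_mul] at h1
    · have hpk : ¬ (p.1 : ℕ) < k + 2 := by
        intro hlt
        rw [hfix p hlt] at hp
        have := congrArg Prod.snd hp
        exact units_ne_neg_self p.2 this
      have h1 : (refl a₀).1 p.opp = p.opp := by
        refine refl_of_ne a₀ ?_ ?_ <;> rw [opp_fst, ne_eq, Fin.ext_iff]
        · rw [hu]; simp only; omega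
        · omega
      refine hw.apply_ne p ?_
      rw [hwb, mul_apply, hp, h1]
    · rw [wordProd_nil, one_mul, inv_one, mul_one, hcomm, hwb]
    · have hd : ¬ IsDescent b a₀ := by
        have h1 : b⁻¹.1 (upper a₀) = upper a₀ := by
          conv_lhs => rw [← hbu]
          exact inv_apply_apply _ _
        have h2 : b⁻¹.1 (lower a₀) = lower a₀ := by
          conv_lhs => rw [← hbl]
          exact inv_apply_apply _ _
        rw [IsDescent, h1, h2]
        exact not_lt.mpr (rhoVal_lower_lt_upper a₀).le
      rw [hwb, invCount_refl_mul hd, List.length_nil]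
      ring
  | cons a A ih =>
    obtain ⟨hp, hlt⟩ := h.of_cons
    have ha := h.lt_upper a (by simp)
    have hrf : FixesBelow (k + 1) (refl a) := fixesBelow_refl ha
    have hrf' : FixesBelow k (refl a) := fun p hp => hrf p (by omega)
    obtain ⟨b, h1, h2, h3, h4⟩ := ih hp (hw.conj a) ((hrf'.mul hk).mul hrf')
      (by rw [mul_apply, mul_apply, hrf (k, 1) (Nat.lt_succ_self _), hj])
    have h5 := hw.invCount_conj hk ha (by rwa [hj])
    refine ⟨b, h1, h2, ?_, ?_⟩
    · have h6 : w = refl a * (refl a * w * refl a) * refl a := by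
        rw [mul_assoc, mul_assoc, refl_mul_self, mul_one, refl_mul_refl_mul]
      rw [h6, h3, wordProd_cons, mul_inv_rev, refl_inv]
      simp only [mul_assoc]
    · rw [List.length_cons]
      omega

/-! ### Poles of the coefficient at the identity -/

theorem fixesBelow_of_nilCoeff_ne_zero {K : ℕ} {l : List (SimpleRoot n)}
    (h : ∀ a ∈ l, K ≤ ((upper a).1 : ℕ)) {v : weylGroup n} (hv : nilCoeff l v ≠ 0) :
    FixesBelow K v := by
  obtain ⟨l', hl, rfl⟩ := exists_sublist_of_nilCoeff_ne_zero hv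
  exact fixesBelow_wordProd fun a ha => h a (hl.subset ha)

theorem shift_nilCoeff {k : Fin n} {l : List (SimpleRoot n)}
    (h : ∀ a ∈ l, (k : ℕ) + 1 ≤ (upper a).1) (v : weylGroup n) :
    shift k (nilCoeff l v) = nilCoeff l v := by
  induction l generalizing v with
  | nil =>
    classical
    rw [nilCoeff_nil]
    split_ifs <;> simp
  | cons a l ih =>
    have ha := h a (by simp)
    have ih := ih fun b hb => h b (by simp [hb])
    have hfst := lower_fst_val a
    have hrt : shift k (rt a) = rt a := by
      rw [rt, map_sub, shift_wt, shift_wt] <;> rw [ne_eq, Fin.ext_iff] <;> omega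
    rw [nilCoeff_cons, map_mul, map_inv₀, hrt, map_sub,
      shift_smul (fixesBelow_refl ha (k, 1) (Nat.lt_succ_self _)), ih, ih]

open Classical in
/-- The numerator of `(ε_k - ε_m)⁻¹` in the coefficient at `1` of the product along the word
`l₁, a₀, l₂`, where `ε_k` occurs in the root `a₀` only. -/
noncomputable def polePart (a₀ : SimpleRoot n) (l₁ l₂ : List (SimpleRoot n)) (m : Letter n) :
    RatFun n :=
  -∑ y : weylGroup n with y.1 (lower a₀) = m, nilCoeff l₁ y * y • nilCoeff l₂ y⁻¹

theorem shift_polePart {k : Fin n} {a₀ : SimpleRoot n} {l₁ l₂ : List (SimpleRoot n)}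
    (h₁ : ∀ a ∈ l₁, (k : ℕ) + 1 ≤ (upper a).1) (h₂ : ∀ a ∈ l₂, (k : ℕ) + 1 ≤ (upper a).1)
    (m : Letter n) : shift k (polePart a₀ l₁ l₂ m) = polePart a₀ l₁ l₂ m := by
  rw [polePart, map_neg, map_sum]
  congr 1
  refine Finset.sum_congr rfl fun y _ => ?_
  by_cases hy : nilCoeff l₁ y = 0
  · rw [hy, zero_mul, map_zero]
  · rw [map_mul, shift_nilCoeff h₁,
      shift_smul (fixesBelow_of_nilCoeff_ne_zero h₁ hy (k, 1) (Nat.lt_succ_self _)),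
      shift_nilCoeff h₂]

theorem nilCoeff_eq_sum_polePart {k : Fin n} {a₀ : SimpleRoot n} {l₁ l₂ : List (SimpleRoot n)}
    (h₀ : upper a₀ = (k, 1)) (h₁ : ∀ a ∈ l₁, (k : ℕ) + 1 ≤ (upper a).1)
    (h₂ : ∀ a ∈ l₂, (k : ℕ) + 1 ≤ (upper a).1) :
    nilCoeff (l₁ ++ a₀ :: l₂) 1 =
      ∑ m with m.1 ≠ k, polePart a₀ l₁ l₂ m / (wt (k, 1) - wt m) := by
  classical
  have hk1 : ((k, 1) : Letter n).1 < (k : ℕ) + 1 := Nat.lt_succ_self _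
  have hlow : (lower a₀).1 ≠ k := by
    have := (upper_fst_ne_lower_fst a₀).symm
    rwa [h₀] at this
  have hfst : ∀ y, nilCoeff l₁ y ≠ 0 → (y.1 (lower a₀)).1 ≠ k := by
    intro y hy
    have h3 := apply_fst_ne y (p := lower a₀) (q := (k, 1)) hlow
    rwa [fixesBelow_of_nilCoeff_ne_zero h₁ hy _ hk1] at h3
  have hterm : ∀ y : weylGroup n, nilCoeff l₁ y * y • nilCoeff (a₀ :: l₂) (y⁻¹ * 1) =
      -(nilCoeff l₁ y * y • nilCoeff l₂ y⁻¹) / (wt (k, 1) - wt (y.1 (lower a₀))) := by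
    intro y
    by_cases hy : nilCoeff l₁ y = 0
    · rw [hy, zero_mul, zero_mul, neg_zero, zero_div]
    · have hfix := fixesBelow_of_nilCoeff_ne_zero h₁ hy
      -- Subwords of `l₂` fix `k`, but `refl a₀ * y⁻¹` moves it. So only the `δ_id` term of the
      -- letter `a₀` contributes, which is the source of the sign in `polePart`.
      have h3 : nilCoeff l₂ (refl a₀ * y⁻¹) = 0 := by
        by_contra hc
        have h4 := fixesBelow_of_nilCoeff_ne_zero h₂ hc (k, 1) hk1
        rw [mul_apply, hfix.inv _ hk1, ← h₀, refl_upper] at h4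
        exact upper_ne_lower a₀ h4.symm
      rw [mul_one, nilCoeff_cons, h3, smul_zero, zero_sub, smul_mul', smul_neg, smul_inv'',
        smul_rt, h₀, hfix _ hk1]
      rw [div_eq_mul_inv]
      ring
  rw [nilCoeff_append, Finset.sum_congr rfl fun y _ => hterm y]
  rw [← Finset.sum_filter_add_sum_filter_not Finset.univ
    (fun y : weylGroup n => (y.1 (lower a₀)).1 ≠ k)]
  have hzero : ∑ y : weylGroup n with ¬ (y.1 (lower a₀)).1 ≠ k,
      -(nilCoeff l₁ y * y • nilCoeff l₂ y⁻¹) / (wt (k, 1) - wt (y.1 (lower a₀))) = 0 := by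
    refine Finset.sum_eq_zero fun y hy => ?_
    have hy0 : nilCoeff l₁ y = 0 := by
      by_contra hc
      exact (Finset.mem_filter.mp hy).2 (hfst y hc)
    rw [hy0, zero_mul, neg_zero, zero_div]
  rw [hzero, add_zero]
  rw [← Finset.sum_fiberwise_of_maps_to (t := Finset.univ.filter fun m : Letter n => m.1 ≠ k)
    (g := fun y : weylGroup n => y.1 (lower a₀))
    (fun y hy => Finset.mem_filter.mpr ⟨Finset.mem_univ _, (Finset.mem_filter.mp hy).2⟩)]
  refine Finset.sum_congr rfl fun m hm => ?_
  rw [polePart, ← Finset.sum_neg_distrib, Finset.sum_div]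
  have hset : (Finset.univ.filter fun y : weylGroup n => (y.1 (lower a₀)).1 ≠ k).filter
      (fun y => y.1 (lower a₀) = m) = Finset.univ.filter fun y => y.1 (lower a₀) = m := by
    ext y
    simp only [Finset.mem_filter, Finset.mem_univ, true_and, and_iff_right_iff_imp]
    rintro rfl
    exact (Finset.mem_filter.mp hm).2
  rw [hset]
  refine Finset.sum_congr rfl fun y hy => ?_
  rw [(Finset.mem_filter.mp hy).2]

/-- A proper subword is too short to descend to the height of `j`. The inequality is not strict, so
other letters at the height of `j` are excluded as well. -/
theorem IsPath.eq_of_sublist {k : Fin n} {a₀ : SimpleRoot n} {A l : List (SimpleRoot n)}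
    {j : Letter n} (h : IsPath k a₀ A j) (hl : l.Sublist A)
    (hj : rhoVal ((wordProd l).1 (lower a₀)) ≤ rhoVal j) : l = A := by
  have h1 := rhoVal_le_wordProd l (lower a₀)
  have h2 := h.rhoVal_add
  exact hl.eq_of_length_le (by omega)

theorem IsPath.eq_reverse_of_sublist {k : Fin n} {a₀ : SimpleRoot n} {A l : List (SimpleRoot n)}
    {j : Letter n} (h : IsPath k a₀ A j) (hl : l.Sublist A.reverse)
    (hj : (wordProd l)⁻¹.1 (lower a₀) = j) : l = A.reverse := by
  have h1 : l.reverse.Sublist A := by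
    have := hl.reverse
    rwa [List.reverse_reverse] at this
  rw [← h.eq_of_sublist h1 (by rw [wordProd_reverse, hj]), List.reverse_reverse]

theorem IsPath.nilCoeff_ne_zero {k : Fin n} {a₀ : SimpleRoot n} {A : List (SimpleRoot n)}
    {j : Letter n} (h : IsPath k a₀ A j) : nilCoeff A (wordProd A) ≠ 0 :=
  nilCoeff_wordProd_ne_zero fun l hl he => h.eq_of_sublist hl (by rw [he, h.apply_lower])

theorem IsPath.nilCoeff_reverse_ne_zero {k : Fin n} {a₀ : SimpleRoot n}
    {A : List (SimpleRoot n)} {j : Letter n} (h : IsPath k a₀ A j) :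
    nilCoeff A.reverse (wordProd A)⁻¹ ≠ 0 := by
  rw [← wordProd_reverse]
  refine nilCoeff_wordProd_ne_zero fun l hl he => h.eq_reverse_of_sublist hl ?_
  rw [he, wordProd_reverse, inv_inv, h.apply_lower]

section Pole

variable {k : Fin n} {a₀ : SimpleRoot n} {A B : List (SimpleRoot n)} {j : Letter n}

theorem IsPath.wordProd_apply_lower (h : IsPath k a₀ A j)
    (hB : ∀ a ∈ B, (k : ℕ) + 2 ≤ (upper a).1) {l : List (SimpleRoot n)} (hl : l.Sublist B) :
    (wordProd l).1 (lower a₀) = lower a₀ :=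
  fixesBelow_wordProd (fun a ha => hB a (hl.subset ha)) _ (by have := h.lower_fst; omega)

/-- Letters of `B` do not move `lower a₀`, so a contributing subword reaches `m` through its part in
`A`; at this height that part is all of `A`, which ends at `j`. -/
theorem IsPath.polePart_eq_zero (h : IsPath k a₀ A j)
    (hB : ∀ a ∈ B, (k : ℕ) + 2 ≤ (upper a).1) (l₂ : List (SimpleRoot n)) {m : Letter n}
    (hm : m ≠ j) (hrho : rhoVal m ≤ rhoVal j) : polePart a₀ (A ++ B) l₂ m = 0 := by
  rw [polePart, neg_eq_zero]
  refine Finset.sum_eq_zero fun y hy => ?_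
  rw [Finset.mem_filter] at hy
  have hy0 : nilCoeff (A ++ B) y = 0 := by
    by_contra hc
    obtain ⟨l, hl, rfl⟩ := exists_sublist_of_nilCoeff_ne_zero hc
    obtain ⟨l₁, l', rfl, h1, h2⟩ := List.sublist_append_iff.mp hl
    have h3 := hy.2
    rw [wordProd_append, mul_apply, h.wordProd_apply_lower hB h2] at h3
    have h4 := h.eq_of_sublist h1 (by rw [h3]; exact hrho)
    rw [h4, h.apply_lower] at h3
    exact hm h3.symm
  rw [hy0, zero_mul]

theorem IsPath.nilCoeff_append_wordProd (h : IsPath k a₀ A j)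
    (hB : ∀ a ∈ B, (k : ℕ) + 2 ≤ (upper a).1) :
    nilCoeff (A ++ B) (wordProd A) = nilCoeff A (wordProd A) * wordProd A • nilCoeff B 1 := by
  rw [nilCoeff_append, Finset.sum_eq_single (wordProd A), inv_mul_cancel]
  · intro z _ hz
    by_contra hc
    obtain ⟨l, hl, rfl⟩ := exists_sublist_of_nilCoeff_ne_zero (left_ne_zero_of_mul hc)
    have h1 : nilCoeff B ((wordProd l)⁻¹ * wordProd A) ≠ 0 := fun h0 =>
      right_ne_zero_of_mul hc (by rw [h0, smul_zero])
    obtain ⟨l', hl', he⟩ := exists_sublist_of_nilCoeff_ne_zero h1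
    have h2 := h.wordProd_apply_lower hB hl'
    rw [he, mul_apply, h.apply_lower] at h2
    have h3 : (wordProd l).1 (lower a₀) = j := by rw [← h2, apply_inv_apply]
    exact hz (by rw [h.eq_of_sublist hl (by rw [h3])])
  · exact fun hc => absurd (Finset.mem_univ _) hc

/-- Reaching `j` requires all of `A.reverse`, which leaves the single summand `y = wordProd A`.
There the left factor also uses all of `A`, so `B` contributes its coefficient at the identity. -/
theorem IsPath.polePart_eq (h : IsPath k a₀ A j)
    (hB : ∀ a ∈ B, (k : ℕ) + 2 ≤ (upper a).1) :
    polePart a₀ (A ++ B) A.reverse j = -(nilCoeff A (wordProd A) *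
      wordProd A • (nilCoeff B 1 * nilCoeff A.reverse (wordProd A)⁻¹)) := by
  rw [polePart, Finset.sum_eq_single (wordProd A), h.nilCoeff_append_wordProd hB, smul_mul',
    mul_assoc]
  · intro y hy hne
    by_contra hc
    have h1 : nilCoeff A.reverse y⁻¹ ≠ 0 := fun h0 =>
      right_ne_zero_of_mul hc (by rw [h0, smul_zero])
    obtain ⟨l, hl, he⟩ := exists_sublist_of_nilCoeff_ne_zero h1
    have h2 := h.eq_reverse_of_sublist hl
      (by rw [he, inv_inv]; exact (Finset.mem_filter.mp hy).2)
    rw [h2, wordProd_reverse, inv_inj] at he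
    exact hne he.symm
  · intro hc
    refine absurd ?_ hc
    rw [Finset.mem_filter]
    exact ⟨Finset.mem_univ _, h.apply_lower⟩

end Pole

/-! ### Recovering the involution from its coefficient -/

/-- The coefficient `c_{w,id}` with the sign `(-1)^{l(w)}`. -/
noncomputable def signedCoeff (w : weylGroup n) : RatFun n := (-1) ^ length w * nilHeckeCoeff w 1

/-- The partial fraction decomposition of `(-1)^{l(w)} c_{w,id}` with respect to `ε_k`, for a basic
involution `w` with `w(k) = j`. -/
theorem IsPath.exists_signedCoeff_eq {k : Fin n} {a₀ : SimpleRoot n} {A : List (SimpleRoot n)}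
    {j : Letter n} (h : IsPath k a₀ A j) {w : weylGroup n} (hw : IsBasic w)
    (hk : FixesBelow k w) (hj : w.1 (k, 1) = j) :
    ∃ (b : weylGroup n) (H : Letter n → RatFun n), FixesBelow (k + 2) b ∧ IsBasic b ∧
      w = wordProd A * b * refl a₀ * (wordProd A)⁻¹ ∧ (∀ m, shift k (H m) = H m) ∧
      signedCoeff w = ∑ m with m.1 ≠ k, H m / (wt (k, 1) - wt m) ∧
      H j = nilCoeff A (wordProd A) *
        wordProd A • (signedCoeff b * nilCoeff A.reverse (wordProd A)⁻¹) ∧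
      ∀ m, m ≠ j → rhoVal m ≤ rhoVal j → H m = 0 := by
  obtain ⟨b, hb, hbb, hwb, hcount⟩ := h.exists_factorization hw hk hj
  obtain ⟨B, hB, rfl⟩ := exists_isReduced b
  have hBK := hB.le_upper hb
  have h₁ : ∀ a ∈ A ++ B, (k : ℕ) + 1 ≤ (upper a).1 := by
    intro a ha
    rcases List.mem_append.mp ha with ha | ha
    · exact h.lt_upper a ha
    · have := hBK a ha
      omega
  have h₂ : ∀ a ∈ A.reverse, (k : ℕ) + 1 ≤ (upper a).1 := fun a ha =>
    h.lt_upper a (List.mem_reverse.mp ha)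
  have hprod : wordProd (A ++ B ++ a₀ :: A.reverse) = w := by
    rw [wordProd_append, wordProd_append, wordProd_cons, wordProd_reverse, hwb]
    simp only [mul_assoc]
  have hred : IsReduced (A ++ B ++ a₀ :: A.reverse) := by
    rw [IsReduced, hprod, hcount, ← hB]
    simp only [List.length_append, List.length_cons, List.length_reverse]
    ring
  have hlen : length w = 2 * A.length + 1 + length (wordProd B) := by
    have h3 := two_mul_length w
    have h4 := two_mul_length (wordProd B)
    omega
  -- The lengths of `w` and `b` differ by an odd number; this sign cancels the one in `polePart`.
  have hsign : ((-1) ^ length w : RatFun n) = -(-1) ^ length (wordProd B) := by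
    rw [hlen, pow_add, pow_add, pow_mul]
    norm_num
  refine ⟨wordProd B, fun m => (-1) ^ length w * polePart a₀ (A ++ B) A.reverse m, hb, hbb, hwb,
    fun m => ?_, ?_, ?_, fun m hm hrho => ?_⟩
  · simp only [map_mul, map_pow, map_neg, map_one, shift_polePart h₁ h₂]
  · rw [signedCoeff, ← hprod, nilHeckeCoeff_eq hred, hprod,
      nilCoeff_eq_sum_polePart h.upper_eq h₁ h₂, Finset.mul_sum]
    simp only [mul_div_assoc]
  · change (-1) ^ length w * polePart a₀ (A ++ B) A.reverse j = _
    rw [h.polePart_eq hBK, signedCoeff, nilHeckeCoeff_eq hB, hsign]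
    simp only [smul_mul', smul_pow', smul_neg, smul_one]
    ring
  · simp only [h.polePart_eq_zero hBK _ hm hrho, mul_zero]

theorem signedCoeff_one : signedCoeff (1 : weylGroup n) = 1 := by
  have h : IsReduced ([] : List (SimpleRoot n)) := by
    rw [IsReduced, wordProd_nil, invCount_one]
    rfl
  have hlen := two_mul_length (1 : weylGroup n)
  rw [invCount_one] at hlen
  have h1 := nilHeckeCoeff_eq h 1
  classical
  rw [nilCoeff_nil, if_pos rfl, wordProd_nil] at h1
  rw [signedCoeff, h1, show length (1 : weylGroup n) = 0 by omega, pow_zero, one_mul]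

theorem shift_signedCoeff {k : Fin n} {w : weylGroup n} (h : FixesBelow (k + 1) w) :
    shift k (signedCoeff w) = signedCoeff w := by
  obtain ⟨B, hB, rfl⟩ := exists_isReduced w
  rw [signedCoeff, nilHeckeCoeff_eq hB, map_mul, map_pow, map_neg, map_one,
    shift_nilCoeff (hB.le_upper h)]

theorem FixesBelow.eq_one {K : ℕ} {w : weylGroup n} (h : FixesBelow K w) (hK : n ≤ K) : w = 1 :=
  ext_apply fun p => h p (p.1.2.trans_le hK)

theorem IsBasic.fixesBelow_or_lt {w : weylGroup n} (hw : IsBasic w) {k : Fin n}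
    (h : FixesBelow k w) : FixesBelow (k + 1) w ∨ (k : ℕ) < (w.1 (k, 1)).1 := by
  rcases (h.le_fst (p := (k, 1)) le_rfl).eq_or_lt with heq | hlt
  · left
    have hfix : w.1 (k, 1) = (k, 1) :=
      (eq_or_eq_opp (q := (k, 1)) (Fin.ext heq.symm)).resolve_right (hw.apply_ne _)
    intro p hp
    by_cases hpk : (p.1 : ℕ) < k
    · exact h p hpk
    · rcases eq_or_eq_opp (p := p) (q := (k, 1)) (Fin.ext (by simp only; omega)) with rfl | rfl
      · exact hfix
      · rw [apply_opp, hfix]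
  · exact Or.inr hlt

theorem fst_ne_of_lt {k : Fin n} {j : Letter n} (h : (k : ℕ) < j.1) : j.1 ≠ k := by
  rintro rfl
  exact lt_irrefl _ h

theorem IsPath.numerator_ne_zero {k : Fin n} {a₀ : SimpleRoot n} {A : List (SimpleRoot n)}
    {j : Letter n} (h : IsPath k a₀ A j) {F : RatFun n} (hF : F ≠ 0) :
    nilCoeff A (wordProd A) * wordProd A • (F * nilCoeff A.reverse (wordProd A)⁻¹) ≠ 0 :=
  mul_ne_zero h.nilCoeff_ne_zero
    ((smul_ne_zero_iff_ne _).mpr (mul_ne_zero hF h.nilCoeff_reverse_ne_zero))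

/-- At the first moved letter the coefficient has a pole at `j`, whose numerator contains the
coefficient of the smaller involution `b`, nonzero by induction. -/
theorem signedCoeff_ne_zero {K : ℕ} {w : weylGroup n} (hw : IsBasic w) (h : FixesBelow K w) :
    signedCoeff w ≠ 0 := by
  induction hd : n - K using Nat.strong_induction_on generalizing K w with
  | _ d ih =>
    subst hd
    by_cases hK : n ≤ K
    · rw [h.eq_one hK, signedCoeff_one]
      exact one_ne_zero
    · let k : Fin n := ⟨K, not_le.mp hK⟩
      rcases hw.fixesBelow_or_lt (k := k) h with h1 | h1
      · exact ih _ (by simp only [k]; omega) hw h1 rfl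
      · obtain ⟨a₀, A, hA⟩ := exists_isPath h1
        obtain ⟨b, H, hb, hbb, -, hH, hsum, hHj, -⟩ := hA.exists_signedCoeff_eq hw h rfl
        intro h0
        have h2 := partialFraction_unique (F := 0) (map_zero _) hH (h0 ▸ hsum) (fst_ne_of_lt h1)
        rw [hHj] at h2
        exact hA.numerator_ne_zero (ih _ (by simp only [k]; omega) hbb hb rfl) h2

/-- One side is free of `ε_k`, while the other has a genuine pole in `ε_k`. -/
theorem signedCoeff_ne_of_fixesBelow {k : Fin n} {v w : weylGroup n} (hv : FixesBelow (k + 1) v)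
    (hw : IsBasic w) (h : FixesBelow k w) (hlt : (k : ℕ) < (w.1 (k, 1)).1) :
    signedCoeff v ≠ signedCoeff w := by
  intro he
  obtain ⟨a₀, A, hA⟩ := exists_isPath hlt
  obtain ⟨b, H, hb, hbb, -, hH, hsum, hHj, -⟩ := hA.exists_signedCoeff_eq hw h rfl
  have h2 := partialFraction_unique (shift_signedCoeff hv) hH (he.trans hsum) (fst_ne_of_lt hlt)
  rw [hHj] at h2
  exact hA.numerator_ne_zero (signedCoeff_ne_zero hbb hb) h2

theorem numerator_eq {k : Fin n} {F : RatFun n} {H H' : Letter n → RatFun n}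
    (hH : ∀ m, shift k (H m) = H m) (hH' : ∀ m, shift k (H' m) = H' m)
    (h : F = ∑ m with m.1 ≠ k, H m / (wt (k, 1) - wt m))
    (h' : F = ∑ m with m.1 ≠ k, H' m / (wt (k, 1) - wt m)) {m : Letter n} (hm : m.1 ≠ k) :
    H m = H' m := by
  rw [← sub_eq_zero]
  refine partialFraction_unique (k := k) (F := 0) (H := fun m => H m - H' m) (map_zero _)
    (fun m => by rw [map_sub, hH, hH']) ?_ hm
  simp only [sub_div, Finset.sum_sub_distrib]
  rw [← h, ← h', sub_self]

/-- The image of `k` under `w` is a pole for `w`, but it is no higher than the image under `v` and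
differs from it, so it is not a pole for `v`. -/
theorem signedCoeff_ne_of_rhoVal_le {k : Fin n} {v w : weylGroup n} (hv : IsBasic v)
    (hvk : FixesBelow k v) (hw : IsBasic w) (hwk : FixesBelow k w)
    (hvlt : (k : ℕ) < (v.1 (k, 1)).1) (hwlt : (k : ℕ) < (w.1 (k, 1)).1)
    (hne : v.1 (k, 1) ≠ w.1 (k, 1)) (hle : rhoVal (w.1 (k, 1)) ≤ rhoVal (v.1 (k, 1))) :
    signedCoeff v ≠ signedCoeff w := by
  intro he
  obtain ⟨a₀, A, hA⟩ := exists_isPath hvlt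
  obtain ⟨a₁, A', hA'⟩ := exists_isPath hwlt
  obtain ⟨-, H, -, -, -, hH, hsum, -, hzero⟩ := hA.exists_signedCoeff_eq hv hvk rfl
  obtain ⟨b, H', hb, hbb, -, hH', hsum', hHj, -⟩ := hA'.exists_signedCoeff_eq hw hwk rfl
  have h1 := numerator_eq hH hH' hsum (he.trans hsum') (fst_ne_of_lt hwlt)
  rw [hzero _ hne.symm hle, hHj] at h1
  exact hA'.numerator_ne_zero (signedCoeff_ne_zero hbb hb) h1.symm

theorem signedCoeff_injective {K : ℕ} {v w : weylGroup n} (hv : IsBasic v) (hvK : FixesBelow K v)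
    (hw : IsBasic w) (hwK : FixesBelow K w) (he : signedCoeff v = signedCoeff w) : v = w := by
  induction hd : n - K using Nat.strong_induction_on generalizing K v w with
  | _ d ih =>
    subst hd
    by_cases hK : n ≤ K
    · rw [hvK.eq_one hK, hwK.eq_one hK]
    let k : Fin n := ⟨K, not_le.mp hK⟩
    rcases hv.fixesBelow_or_lt (k := k) hvK with h1 | h1 <;>
      rcases hw.fixesBelow_or_lt (k := k) hwK with h2 | h2
    · exact ih _ (by simp only [k]; omega) hv h1 hw h2 he rfl
    · exact absurd he (signedCoeff_ne_of_fixesBelow h1 hw hwK h2)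
    · exact absurd he.symm (signedCoeff_ne_of_fixesBelow h2 hv hvK h1)
    · by_cases hj : v.1 (k, 1) = w.1 (k, 1)
      · obtain ⟨a₀, A, hA⟩ := exists_isPath h1
        obtain ⟨b, H, hb, hbb, hvb, hH, hsum, hHj, -⟩ := hA.exists_signedCoeff_eq hv hvK rfl
        obtain ⟨b', H', hb', hbb', hwb, hH', hsum', hHj', -⟩ :=
          hA.exists_signedCoeff_eq hw hwK hj.symm
        have h3 := numerator_eq hH hH' hsum (he.trans hsum') (fst_ne_of_lt h1)
        -- Both numerators are built from the same path `A`, so its nonzero factors and the action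
        -- of `wordProd A` cancel, leaving the coefficients of `b` and `b'`.
        rw [hHj, hHj', mul_right_inj' hA.nilCoeff_ne_zero, smul_left_cancel_iff,
          mul_left_inj' hA.nilCoeff_reverse_ne_zero] at h3
        rw [hvb, hwb, ih _ (by simp only [k]; omega) hbb hb hbb' hb' h3 rfl]
      · rcases le_total (rhoVal (w.1 (k, 1))) (rhoVal (v.1 (k, 1))) with hle | hle
        · exact absurd he (signedCoeff_ne_of_rhoVal_le hv hvK hw hwK h1 h2 hj hle)
        · exact absurd he.symm
            (signedCoeff_ne_of_rhoVal_le hw hwK hv hvK h2 h1 (Ne.symm hj) hle)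

theorem prod_rootPoly_ne_zero :
    ∏ a : PosRoot n, algebraMap (Poly n) (RatFun n) (rootPoly a) ≠ 0 := by
  refine Finset.prod_ne_zero_iff.mpr fun a _ => ?_
  rw [rootPoly, map_sub]
  exact wt_sub_ne_zero fun h => a.2.ne (congrArg Prod.fst h)

end TypeD

theorem proposition2p8 (n : ℕ) (hn : 4 ≤ n) (σ τ : TypeD.weylGroup n)
    (hσ : TypeD.IsBasicInvolution σ) (hτ : TypeD.IsBasicInvolution τ) (hne : σ ≠ τ) :
    TypeD.kostantKumar σ ≠ TypeD.kostantKumar τ := by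
  intro h
  refine hne (TypeD.signedCoeff_injective (K := 0) hσ.isBasic ?_ hτ.isBasic ?_
    (mul_right_cancel₀ TypeD.prod_rootPoly_ne_zero h))
  · exact fun p hp => absurd hp (Nat.not_lt_zero _)
  · exact fun p hp => absurd hp (Nat.not_lt_zero _)
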